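/- Let $q\in\mathbb R$ with $q<1$ and $q\neq-1$, and put $[n]_{-q}=\frac{(-q)^n-1}{(-q)-1}=\frac{1-(-q)^n}{1+q}$ for $n=0,1,2,\dots$ (with $(-q)^0=1$). Let $a_\mu,a_\mu^\dagger$ and $b_\nu,b_\nu^\dagger$ ($\mu$, $\nu$ ranging over finite sets) be two families of $q$-fermions on a complex inner product space, that is, operators, with $a_\mu^\dagger,b_\nu^\dagger$ adjoint to $a_\mu,b_\nu$, satisfying $$a_\mu a^\dagger_{\mu'}+q^{\delta_{\mu\mu'}}a^\dagger_{\mu'}a_\mu=\delta_{\mu\mu'},\qquad b_\nu b^\dagger_{\nu'}+q^{\delta_{\nu\nu'}}b^\dagger_{\nu'}b_\nu=\delta_{\nu\nu'},$$ $$a_\mu a_{\mu'}+a_{\mu'}a_\mu=0\ (\mu\ne\mu'),\qquad b_\nu b_{\nu'}+b_{\nu'}b_\nu=0\ (\nu\neq\nu'),$$ such that each of $a_\mu,a_\mu^\dagger$ anticommutes with each of $b_\nu,b_\nu^\dagger$, and let $|O\rangle$ be a unit vector with $a_\mu|O\rangle=b_\nu|O\rangle=0$ for all $\mu,\nu$.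 For a nonempty family of complex matrices $\Phi_\alpha=(\Phi_\alpha^{\mu\nu})$ with $\operatorname{Tr}\Phi_\alpha\Phi_\beta^\dagger=\delta_{\alpha\beta}$ define the quasiboson operators $$A_\alpha^\dagger=\sum_{\mu,\nu}\Phi_\alpha^{\mu\nu}a_\mu^\dagger b_\nu^\dagger,\qquad A_\alpha=\sum_{\mu,\nu}\overline{\Phi_\alpha^{\mu\nu}}\,b_\nu a_\mu .$$ Write $S\cong T$ if $S$ and $T$ agree on all states $A^\dagger_{\gamma_1}\cdots A^\dagger_{\gamma_n}|O\rangle$, $n\ge0$. Functions of operators are defined through (joint) eigenvectors with real eigenvalues: $f(T)v=f(x)v$ if $Tv=xv$, and $\chi(S,T)v=\chi(x,y)v$ if $Sv=xv$, $Tv=yv$, extended linearly to the span of such vectors; an assertion $S\cong f(T)$ or $N\cong\chi(S,T)$ includes that all the states above belong to this span. For $\phi:\mathbb R\to\mathbb R$ and operators $N_\alpha$, the quasibosons are said to be realized by independent deformed oscillators with structure function $\phi$ and number operators $N_\alpha$ if $N_\alpha|O\rangle=0$ and $$A_\alpha^\dagger A_\alpha\cong\phi(N_\alpha),\qquad A_\alpha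 A_\alpha^\dagger\cong\phi(N_\alpha+1),$$ $$[A_\alpha^\dagger,A_\beta^\dagger]\cong0,\quad [A_\alpha,A_\beta]\cong0,\quad [A_\alpha,A_\beta^\dagger]\cong0\qquad(\alpha\neq\beta),$$ $$[N_\alpha,A_\alpha^\dagger]\cong A_\alpha^\dagger,\qquad [N_\alpha,A_\alpha]\cong-A_\alpha .\tag{$*$}$$ Consider the condition (S) each $\Phi_\alpha$ has exactly one nonzero entry, $\Phi_\alpha^{\mu\nu}=\Phi_\alpha^{\mu_0(\alpha)\nu_0(\alpha)}\delta_{\mu\mu_0(\alpha)}\delta_{\nu\nu_0(\alpha)}$, with $|\Phi_\alpha^{\mu_0(\alpha)\nu_0(\alpha)}|=1$, and for different $\alpha$ these entries lie in different rows and in different columns. Then: 1. If the quasibosons are realized by independent deformed oscillators with structure function $\phi$ and some number operators $N_\alpha$, then (S) holds and $$\phi(n)=\bigl([n]_{-q}\bigr)^2=\Bigl(\frac{1-(-q)^n}{1+q}\Bigr)^2,\qquad n=0,1,2,\dots$$ 2. Conversely, if (S) holds and $\phi(n)=([n]_{-q})^2$ for all $n\ge0$, then there are number operators $N_\alpha$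 with which the quasibosons are realized by independent deformed oscillators with structure function $\phi$; they can be chosen so that moreover $[N_\alpha,A_\beta^\dagger]\cong0$ and $[N_\alpha,A_\beta]\cong0$ for $\alpha\ne\beta$. 3. Suppose (S), let $\chi:\mathbb R^2\to\mathbb R$, and fix $\alpha$. There is an operator $N_\alpha$ with $N_\alpha\cong\chi(A_\alpha^\dagger A_\alpha,A_\alpha A_\alpha^\dagger)$, and for every such $N_\alpha$ the relations $(*)$ hold if and only if $$\chi\bigl([n+1]_{-q}^2,[n+2]_{-q}^2\bigr)-\chi\bigl([n]_{-q}^2,[n+1]_{-q}^2\bigr)=1,\qquad n=0,1,2,\dots$$ -/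

import Mathlib

noncomputable section

/-- The `q`-number `[n]_{-q} = ((-q)^n - 1) / ((-q) - 1)`, meaningful for `q ≠ -1`. -/
def qNum (q : ℝ) (n : ℕ) : ℝ := ((-q) ^ n - 1) / ((-q) - 1)

/-- Two families of `q`-deformed fermions, with modes labelled by `M` and `K`, together with
their vacuum. The operators act on a complex inner product space `V`; it need not be complete
(for example a common invariant dense domain of possibly unbounded operators in a Hilbert
space), and the creation operators are the adjoints of the annihilation operators on `V`.
The remaining relations between creation operators (and between `adag` and `b`) are the
adjoints of the listed ones. -/
structure QFermionSystem (q : ℝ) (M K V : Type*) [DecidableEq M] [DecidableEq K]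
    [NormedAddCommGroup V] [InnerProductSpace ℂ V] where
  a : M → Module.End ℂ V
  adag : M → Module.End ℂ V
  b : K → Module.End ℂ V
  bdag : K → Module.End ℂ V
  vac : V
  adjoint_a : ∀ (μ : M) (x y : V), inner ℂ (adag μ x) y = inner ℂ x (a μ y)
  adjoint_b : ∀ (ν : K) (x y : V), inner ℂ (bdag ν x) y = inner ℂ x (b ν y)
  a_adag : ∀ μ μ' : M, a μ * adag μ' + ((q : ℂ) ^ (if μ = μ' then 1 else 0)) • (adag μ' * a μ) =
    if μ = μ' then 1 else 0
  b_bdag : ∀ ν ν' : K, b ν * bdag ν' + ((q : ℂ) ^ (if ν = ν' then 1 else 0)) • (bdag ν' * b ν) =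
    if ν = ν' then 1 else 0
  a_a : ∀ μ μ' : M, μ ≠ μ' → a μ * a μ' + a μ' * a μ = 0
  b_b : ∀ ν ν' : K, ν ≠ ν' → b ν * b ν' + b ν' * b ν = 0
  a_b : ∀ (μ : M) (ν : K), a μ * b ν + b ν * a μ = 0
  a_bdag : ∀ (μ : M) (ν : K), a μ * bdag ν + bdag ν * a μ = 0
  norm_vac : ‖vac‖ = 1
  a_vac : ∀ μ : M, a μ vac = 0
  b_vac : ∀ ν : K, b ν vac = 0

/-- The graph of the operator `f(T)`: its domain is the linear span of the eigenvectors of `T`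
with real eigenvalues, and `f(T) v = f(x) v` whenever `T v = x v`. -/
def opFun {V : Type*} [AddCommGroup V] [Module ℂ V] (T : Module.End ℂ V) (f : ℝ → ℝ) :
    Submodule ℂ (V × V) :=
  Submodule.span ℂ {p | ∃ x : ℝ, T p.1 = (x : ℂ) • p.1 ∧ p.2 = (f x : ℂ) • p.1}

/-- The graph of the operator `χ(S, T)`: its domain is the linear span of the joint eigenvectors
of `S` and `T` with real eigenvalues, and `χ(S, T) v = χ(x, y) v` whenever `S v = x v` and
`T v = y v`. -/
def opFun₂ {V : Type*} [AddCommGroup V] [Module ℂ V] (S T : Module.End ℂ V) (χ : ℝ → ℝ → ℝ) :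
    Submodule ℂ (V × V) :=
  Submodule.span ℂ {p | ∃ x y : ℝ, S p.1 = (x : ℂ) • p.1 ∧ T p.1 = (y : ℂ) • p.1 ∧
    p.2 = (χ x y : ℂ) • p.1}

section Quasibosons

variable {q : ℝ} {M K ι V : Type*} [Fintype M] [DecidableEq M] [Fintype K] [DecidableEq K]
  [NormedAddCommGroup V] [InnerProductSpace ℂ V]

/-- The quasiboson creation operator `∑ Φ^{μν} a†_μ b†_ν`. -/
def QFermionSystem.cre (F : QFermionSystem q M K V) (Φ : Matrix M K ℂ) : Module.End ℂ V :=
  ∑ μ, ∑ ν, Φ μ ν • (F.adag μ * F.bdag ν)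

/-- The quasiboson annihilation operator `∑ conj(Φ^{μν}) b_ν a_μ`. -/
def QFermionSystem.ann (F : QFermionSystem q M K V) (Φ : Matrix M K ℂ) : Module.End ℂ V :=
  ∑ μ, ∑ ν, star (Φ μ ν) • (F.b ν * F.a μ)

/-- The normalization `Tr (Φ_α Φ_β†) = δ_{αβ}`. -/
def IsNormalized [DecidableEq ι] (Φ : ι → Matrix M K ℂ) : Prop :=
  ∀ α β, (Φ α * (Φ β).conjTranspose).trace = if α = β then 1 else 0

/-- The quasiboson states `A†_{γ₁} ⋯ A†_{γₙ} |O⟩`, `n ≥ 0`. -/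
def QFermionSystem.states (F : QFermionSystem q M K V) (Φ : ι → Matrix M K ℂ) : Set V :=
  {ψ | ∃ γ : List ι, ψ = (γ.map fun α => F.cre (Φ α)).prod F.vac}

/-- Weak equality `S ≅ T`: the two operators agree on all quasiboson states. -/
def QFermionSystem.WeakEq (F : QFermionSystem q M K V) (Φ : ι → Matrix M K ℂ)
    (S T : Module.End ℂ V) : Prop :=
  ∀ ψ ∈ F.states Φ, S ψ = T ψ

/-- `S ≅ f(T)`. -/
def QFermionSystem.WeakEqFun (F : QFermionSystem q M K V) (Φ : ι → Matrix M K ℂ)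
    (S T : Module.End ℂ V) (f : ℝ → ℝ) : Prop :=
  ∀ ψ ∈ F.states Φ, (ψ, S ψ) ∈ opFun T f

/-- `N ≅ χ(S, T)`. -/
def QFermionSystem.WeakEqFun₂ (F : QFermionSystem q M K V) (Φ : ι → Matrix M K ℂ)
    (N S T : Module.End ℂ V) (χ : ℝ → ℝ → ℝ) : Prop :=
  ∀ ψ ∈ F.states Φ, (ψ, N ψ) ∈ opFun₂ S T χ

/-- The relations `[N_α, A†_α] ≅ A†_α` and `[N_α, A_α] ≅ -A_α` of a number operator. -/
def QFermionSystem.NumberRel (F : QFermionSystem q M K V) (Φ : ι → Matrix M K ℂ)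
    (N : Module.End ℂ V) (α : ι) : Prop :=
  F.WeakEq Φ ⁅N, F.cre (Φ α)⁆ (F.cre (Φ α)) ∧ F.WeakEq Φ ⁅N, F.ann (Φ α)⁆ (-F.ann (Φ α))

/-- The quasibosons with matrices `Φ` and number operators `N` are a realization of independent
deformed oscillators with structure function `φ`. -/
structure QFermionSystem.IsRealization (F : QFermionSystem q M K V) (Φ : ι → Matrix M K ℂ)
    (φ : ℝ → ℝ) (N : ι → Module.End ℂ V) : Prop where
  number_vac : ∀ α, N α F.vac = 0
  cre_ann : ∀ α, F.WeakEqFun Φ (F.cre (Φ α) * F.ann (Φ α)) (N α) φ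
  ann_cre : ∀ α, F.WeakEqFun Φ (F.ann (Φ α) * F.cre (Φ α)) (N α + 1) φ
  cre_cre : ∀ α β, α ≠ β → F.WeakEq Φ ⁅F.cre (Φ α), F.cre (Φ β)⁆ 0
  ann_ann : ∀ α β, α ≠ β → F.WeakEq Φ ⁅F.ann (Φ α), F.ann (Φ β)⁆ 0
  ann_cre_indep : ∀ α β, α ≠ β → F.WeakEq Φ ⁅F.ann (Φ α), F.cre (Φ β)⁆ 0
  number_rel : ∀ α, F.NumberRel Φ (N α) α

/-- Every `Φ_α` has exactly one nonzero entry, this entry has modulus one, and for different `α`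
the nonzero entries lie in different rows and in different columns. -/
def IsSingleEntry (Φ : ι → Matrix M K ℂ) : Prop :=
  ∃ (μ₀ : ι → M) (ν₀ : ι → K), Function.Injective μ₀ ∧ Function.Injective ν₀ ∧
    ∀ α, ‖Φ α (μ₀ α) (ν₀ α)‖ = 1 ∧
      ∀ μ ν, Φ α μ ν = if μ = μ₀ α ∧ ν = ν₀ α then Φ α (μ₀ α) (ν₀ α) else 0

end Quasibosons

end

noncomputable section

/-! Under (S) each quasiboson is a single pair of modes and different quasibosons share no mode, so
the fermionic signs cancel in pairs. On a state containing `n` copies of `α`, both `a†a` and `b†b`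
for its modes have eigenvalue `[n]_{-q}`; hence `A†A` has eigenvalue `[n]²` and `AA†` has eigenvalue
`[n+1]²`. Since `q < 1` makes `[n]` positive for `n ≥ 1`, all states are nonzero, and states of
different multisets are orthogonal. Any function of the number of copies therefore extends to an
operator (`exists_number_operator`), and the number relations say that its eigenvalue grows by one
per quasiboson (`numberRel_iff`). This gives the second and third claims.

For the first claim, a realization forces `A (A†)ⁿ⁺¹|O⟩ = cₙ (A†)ⁿ|O⟩` for each single `Φ`. Pairing
with a test vector `x` turns this into `conj(cₙ) ⟨O|Aⁿ x⟩ = ⟨O|Aⁿ⁺¹A† x⟩` (`inner_vac_ann_pow`), and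
two choices of test vectors pin down `Φ`.

If row `r` had nonzero entries at `s` and `t`, the vectors `(b†_s)ⁱ(b†_t)ʲ(a†_r)⁵|O⟩` with `i = 0,
2, 4`, `i + j = 5` would give three linear equations in which the other entries of `Φ` enter through
two unknowns only. Their consistency is a polynomial condition on `q` with no admissible root but `q
= 0`, which one equation excludes (`row_unique`). Exchanging the two families handles columns.

The nonzero entries of `Φ` then behave like independent oscillators. Two of them would make `[n]²/n`
an arithmetic progression for `n = 1, …, 4`, which is impossible (`pairState_relation`,
`entry_unique`). Normalization fixes the modulus of the remaining entry, and commutation of the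
`A†_α` on the vacuum separates rows and columns. Finally `φ` is read off from `AA†` on powers of
`A†`. -/

theorem qNum_zero (q : ℝ) : qNum q 0 = 0 := by simp [qNum]

theorem qNum_succ {q : ℝ} (hq : q ≠ -1) (n : ℕ) : qNum q (n + 1) = 1 - q * qNum q n := by
  have h : -q - 1 ≠ 0 := fun h => hq (by linarith)
  unfold qNum
  field_simp
  ring

theorem qNum_one {q : ℝ} (hq : q ≠ -1) : qNum q 1 = 1 := by
  rw [qNum_succ hq, qNum_zero]; ring

theorem qNum_succ_pos {q : ℝ} (hq : q < 1) (hq' : q ≠ -1) (n : ℕ) : 0 < qNum q (n + 1) := by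
  rcases le_or_gt q 0 with h | h
  · induction n with
    | zero => rw [qNum_one hq']; exact one_pos
    | succ n ih => rw [qNum_succ hq']; nlinarith
  · have h1 : |(-q) ^ (n + 1)| < 1 := by
      rw [abs_pow, abs_neg, abs_of_pos h]
      exact pow_lt_one₀ h.le hq (Nat.succ_ne_zero n)
    have h2 := (abs_lt.mp h1).2
    exact div_pos_of_neg_of_neg (by linarith) (by linarith)

theorem qNum_succ_complex {q : ℝ} (hq : q ≠ -1) (n : ℕ) :
    ((qNum q (n + 1) : ℝ) : ℂ) = 1 - (q : ℂ) * (qNum q n : ℝ) := by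
  rw [qNum_succ hq]; push_cast; ring

/-! ### Functions of operators are single-valued on eigenvectors -/

section FunctionalCalculus

variable {V : Type*} [AddCommGroup V] [Module ℂ V]

/-- An operator that acts as prescribed on finitely many joint eigenspaces. -/
theorem exists_end_on_joint_eigenvectors (S T : Module.End ℂ V) (χ : ℝ → ℝ → ℝ)
    (s : Finset ℝ) :
    ∃ R : Module.End ℂ V, ∀ x ∈ s, ∀ y ∈ s, ∀ v : V, S v = (x : ℂ) • v → T v = (y : ℂ) • v →
      R v = (χ x y : ℂ) • v := by
  classical
  -- Lagrange basis polynomials in `S` and `T` act on joint eigenvectors as indicators of the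
  -- eigenvalues; `S` and `T` need not commute.
  let L : ℝ → Polynomial ℂ := fun i => Lagrange.basis s (fun x : ℝ => (x : ℂ)) i
  have hinj : Set.InjOn (fun x : ℝ => (x : ℂ)) (s : Set ℝ) := Complex.ofReal_injective.injOn
  have hL : ∀ (U : Module.End ℂ V) (i x : ℝ), i ∈ s → x ∈ s → ∀ v : V, U v = (x : ℂ) • v →
      Polynomial.aeval U (L i) v = (if i = x then (1 : ℂ) else 0) • v := by
    intro U i x hi hx v hv
    have h := Module.End.aeval_apply_of_hasEigenvector (f := U) (p := L i) (μ := (x : ℂ)) (x := v)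
    by_cases hv0 : v = 0
    · simp [hv0]
    rw [h ⟨Module.End.mem_eigenspace_iff.mpr hv, hv0⟩]
    congr 1
    split_ifs with hix
    · subst hix; exact Lagrange.eval_basis_self hinj hi
    · exact Lagrange.eval_basis_of_ne (v := fun x : ℝ => (x : ℂ)) hix hx
  refine ⟨∑ i ∈ s, ∑ j ∈ s, (χ i j : ℂ) • (Polynomial.aeval S (L i) * Polynomial.aeval T (L j)),
    fun x hx y hy v hS hT => ?_⟩
  simp only [LinearMap.sum_apply, LinearMap.smul_apply, Module.End.mul_apply]
  rw [Finset.sum_eq_single x]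
  · rw [Finset.sum_eq_single y]
    · rw [hL T y y hy hy v hT, map_smul, hL S x x hx hx v hS]; simp
    · intro j hj hjy
      rw [hL T j y hj hy v hT]; simp [hjy]
    · exact fun h => absurd hy h
  · intro i hi hix
    refine Finset.sum_eq_zero fun j hj => ?_
    rw [hL T j y hj hy v hT, map_smul, hL S i x hi hx v hS]; simp [hix]
  · exact fun h => absurd hx h

/-- An element of the span involves finitely many eigenvalues, so it lies in the graph of every
operator with the right action on those joint eigenspaces. Enlarging the finite set by `x` and `y`
lets one such operator also evaluate `v`. -/
theorem opFun₂_apply_eigenvector {S T : Module.End ℂ V} {χ : ℝ → ℝ → ℝ} {v w : V}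
    (h : (v, w) ∈ opFun₂ S T χ) {x y : ℝ} (hS : S v = (x : ℂ) • v) (hT : T v = (y : ℂ) • v) :
    w = (χ x y : ℂ) • v := by
  classical
  have key : ∀ p ∈ opFun₂ S T χ, ∃ s : Finset ℝ, ∀ R : Module.End ℂ V,
      (∀ x ∈ s, ∀ y ∈ s, ∀ v : V, S v = (x : ℂ) • v → T v = (y : ℂ) • v →
        R v = (χ x y : ℂ) • v) → p.2 = R p.1 := by
    intro p hp
    induction hp using Submodule.span_induction with
    | mem p hp =>
      obtain ⟨x, y, h1, h2, h3⟩ := hp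
      exact ⟨{x, y}, fun R hR => by rw [h3, hR x (by simp) y (by simp) _ h1 h2]⟩
    | zero => exact ⟨∅, fun R _ => by simp⟩
    | add p p' _ _ ih ih' =>
      obtain ⟨s, hs⟩ := ih
      obtain ⟨s', hs'⟩ := ih'
      refine ⟨s ∪ s', fun R hR => ?_⟩
      rw [Prod.snd_add, Prod.fst_add, map_add,
        hs R fun x hx y hy => hR x (Finset.mem_union_left _ hx) y (Finset.mem_union_left _ hy),
        hs' R fun x hx y hy => hR x (Finset.mem_union_right _ hx) y (Finset.mem_union_right _ hy)]
    | smul c p _ ih =>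
      obtain ⟨s, hs⟩ := ih
      exact ⟨s, fun R hR => by rw [Prod.smul_snd, Prod.smul_fst, map_smul, hs R hR]⟩
  obtain ⟨s, hs⟩ := key _ h
  obtain ⟨R, hR⟩ := exists_end_on_joint_eigenvectors S T χ (s ∪ {x, y})
  have h1 := hs R fun x hx y hy => hR x (Finset.mem_union_left _ hx) y (Finset.mem_union_left _ hy)
  rw [show w = R v from h1, hR x (by simp) y (by simp) v hS hT]

theorem opFun_apply_eigenvector {T : Module.End ℂ V} {f : ℝ → ℝ} {v w : V}
    (h : (v, w) ∈ opFun T f) {x : ℝ} (hT : T v = (x : ℂ) • v) : w = (f x : ℂ) • v := by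
  have hle : opFun T f ≤ opFun₂ T T fun x _ => f x :=
    Submodule.span_mono fun p ⟨x, h1, h2⟩ => ⟨x, x, h1, h1, h2⟩
  exact opFun₂_apply_eigenvector (hle h) hT hT

end FunctionalCalculus

/-! ### Relations among the modes and their adjoints -/

namespace QFermionSystem

variable {q : ℝ} {M K V : Type*} [DecidableEq M] [DecidableEq K]
  [NormedAddCommGroup V] [InnerProductSpace ℂ V] (F : QFermionSystem q M K V)

theorem inner_adag (μ : M) (x y : V) : inner ℂ (F.adag μ x) y = inner ℂ x (F.a μ y) :=
  F.adjoint_a μ x y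

theorem inner_bdag (ν : K) (x y : V) : inner ℂ (F.bdag ν x) y = inner ℂ x (F.b ν y) :=
  F.adjoint_b ν x y

theorem inner_a (μ : M) (x y : V) : inner ℂ (F.a μ x) y = inner ℂ x (F.adag μ y) := by
  rw [← inner_conj_symm, ← F.inner_adag, inner_conj_symm]

theorem inner_b (ν : K) (x y : V) : inner ℂ (F.b ν x) y = inner ℂ x (F.bdag ν y) := by
  rw [← inner_conj_symm, ← F.inner_bdag, inner_conj_symm]

theorem a_adag_self (μ : M) (x : V) :
    F.a μ (F.adag μ x) = x - (q : ℂ) • F.adag μ (F.a μ x) := by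
  have h := LinearMap.congr_fun (F.a_adag μ μ) x
  simp at h
  exact eq_sub_of_add_eq h

theorem a_adag_ne {μ μ' : M} (hμ : μ ≠ μ') (x : V) :
    F.a μ (F.adag μ' x) = -F.adag μ' (F.a μ x) := by
  have h := LinearMap.congr_fun (F.a_adag μ μ') x
  simp [hμ] at h
  exact eq_neg_of_add_eq_zero_left h

theorem b_bdag_self (ν : K) (x : V) :
    F.b ν (F.bdag ν x) = x - (q : ℂ) • F.bdag ν (F.b ν x) := by
  have h := LinearMap.congr_fun (F.b_bdag ν ν) x
  simp at h
  exact eq_sub_of_add_eq h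

theorem b_bdag_ne {ν ν' : K} (hν : ν ≠ ν') (x : V) :
    F.b ν (F.bdag ν' x) = -F.bdag ν' (F.b ν x) := by
  have h := LinearMap.congr_fun (F.b_bdag ν ν') x
  simp [hν] at h
  exact eq_neg_of_add_eq_zero_left h

theorem a_a_ne {μ μ' : M} (hμ : μ ≠ μ') (x : V) : F.a μ (F.a μ' x) = -F.a μ' (F.a μ x) :=
  eq_neg_of_add_eq_zero_left (by simpa using LinearMap.congr_fun (F.a_a μ μ' hμ) x)

theorem b_b_ne {ν ν' : K} (hν : ν ≠ ν') (x : V) : F.b ν (F.b ν' x) = -F.b ν' (F.b ν x) :=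
  eq_neg_of_add_eq_zero_left (by simpa using LinearMap.congr_fun (F.b_b ν ν' hν) x)

theorem a_b_apply (μ : M) (ν : K) (x : V) : F.a μ (F.b ν x) = -F.b ν (F.a μ x) :=
  eq_neg_of_add_eq_zero_left (by simpa using LinearMap.congr_fun (F.a_b μ ν) x)

theorem a_bdag_apply (μ : M) (ν : K) (x : V) : F.a μ (F.bdag ν x) = -F.bdag ν (F.a μ x) :=
  eq_neg_of_add_eq_zero_left (by simpa using LinearMap.congr_fun (F.a_bdag μ ν) x)

theorem adag_adag_ne {μ μ' : M} (hμ : μ ≠ μ') (x : V) :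
    F.adag μ (F.adag μ' x) = -F.adag μ' (F.adag μ x) :=
  ext_inner_right ℂ fun y => by
    simp only [inner_neg_left, inner_adag]
    rw [F.a_a_ne hμ.symm, inner_neg_right]

theorem bdag_bdag_ne {ν ν' : K} (hν : ν ≠ ν') (x : V) :
    F.bdag ν (F.bdag ν' x) = -F.bdag ν' (F.bdag ν x) :=
  ext_inner_right ℂ fun y => by
    simp only [inner_neg_left, inner_bdag]
    rw [F.b_b_ne hν.symm, inner_neg_right]

theorem adag_bdag (μ : M) (ν : K) (x : V) : F.adag μ (F.bdag ν x) = -F.bdag ν (F.adag μ x) :=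
  ext_inner_right ℂ fun y => by
    simp only [inner_neg_left, inner_adag, inner_bdag]
    rw [F.a_b_apply, inner_neg_right, neg_neg]

theorem adag_b (μ : M) (ν : K) (x : V) : F.adag μ (F.b ν x) = -F.b ν (F.adag μ x) :=
  ext_inner_right ℂ fun y => by
    simp only [inner_neg_left, inner_adag, inner_b]
    rw [F.a_bdag_apply, inner_neg_right, neg_neg]

/-- The same system with the roles of the two families of modes exchanged. -/
def swap : QFermionSystem q K M V where
  a := F.b
  adag := F.bdag
  b := F.a
  bdag := F.adag
  vac := F.vac
  adjoint_a := F.adjoint_b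
  adjoint_b := F.adjoint_a
  a_adag := F.b_bdag
  b_bdag := F.a_adag
  a_a := F.b_b
  b_b := F.a_a
  a_b := fun ν μ => by rw [add_comm]; exact F.a_b μ ν
  a_bdag := fun ν μ => LinearMap.ext fun x => by simp [F.adag_b]
  norm_vac := F.norm_vac
  a_vac := F.b_vac
  b_vac := F.a_vac

theorem inner_vac_vac : inner ℂ F.vac F.vac = (1 : ℂ) := by
  rw [inner_self_eq_norm_sq_to_K, F.norm_vac]; simp

theorem inner_vac_bdag (ν : K) (x : V) : inner ℂ F.vac (F.bdag ν x) = (0 : ℂ) := by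
  rw [← inner_b, F.b_vac, inner_zero_left]

theorem vac_ne_zero : F.vac ≠ 0 := by
  intro h
  have := F.norm_vac
  rw [h, norm_zero] at this
  exact zero_ne_one this

section Composite

variable [Fintype M] [Fintype K]

theorem cre_apply (Φ : Matrix M K ℂ) (x : V) :
    F.cre Φ x = ∑ μ, ∑ ν, Φ μ ν • F.adag μ (F.bdag ν x) := by
  simp [cre]

theorem ann_apply (Φ : Matrix M K ℂ) (x : V) :
    F.ann Φ x = ∑ μ, ∑ ν, star (Φ μ ν) • F.b ν (F.a μ x) := by
  simp [ann]

theorem cre_swap (Φ : Matrix M K ℂ) : F.swap.cre Φ.transpose = -F.cre Φ := by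
  refine LinearMap.ext fun x => ?_
  rw [LinearMap.neg_apply, cre_apply, cre_apply, Finset.sum_comm]
  simp only [← Finset.sum_neg_distrib, F.adag_bdag, smul_neg, neg_neg]
  rfl

theorem ann_swap (Φ : Matrix M K ℂ) : F.swap.ann Φ.transpose = -F.ann Φ := by
  refine LinearMap.ext fun x => ?_
  rw [LinearMap.neg_apply, ann_apply, ann_apply, Finset.sum_comm]
  simp only [← Finset.sum_neg_distrib, ← smul_neg, ← F.a_b_apply]
  rfl

theorem inner_cre (Φ : Matrix M K ℂ) (x y : V) :
    inner ℂ (F.cre Φ x) y = inner ℂ x (F.ann Φ y) := by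
  simp only [cre_apply, ann_apply, sum_inner, inner_sum, inner_smul_left, inner_smul_right,
    inner_adag, inner_bdag]
  rfl

theorem inner_ann (Φ : Matrix M K ℂ) (x y : V) :
    inner ℂ (F.ann Φ x) y = inner ℂ x (F.cre Φ y) := by
  rw [← inner_conj_symm, ← F.inner_cre, inner_conj_symm]

theorem inner_cre_pow (Φ : Matrix M K ℂ) (n : ℕ) (x y : V) :
    inner ℂ ((F.cre Φ ^ n) x) y = inner ℂ x ((F.ann Φ ^ n) y) := by
  induction n generalizing y with
  | zero => simp
  | succ n ih => rw [pow_succ', Module.End.mul_apply, inner_cre, ih, pow_succ, Module.End.mul_apply]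

theorem ann_vac (Φ : Matrix M K ℂ) : F.ann Φ F.vac = 0 := by
  simp [ann_apply, F.a_vac]

end Composite

end QFermionSystem

/-! ### Quasibosons under condition (S) -/

namespace QFermionSystem

variable {q : ℝ} {M K ι V : Type*} [Fintype M] [DecidableEq M] [Fintype K] [DecidableEq K]
  [NormedAddCommGroup V] [InnerProductSpace ℂ V] (F : QFermionSystem q M K V)

theorem cre_of_single {Φ : Matrix M K ℂ} {r : M} {s : K}
    (h : ∀ μ ν, Φ μ ν = if μ = r ∧ ν = s then Φ r s else 0) (x : V) :
    F.cre Φ x = Φ r s • F.adag r (F.bdag s x) := by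
  rw [cre_apply, Finset.sum_eq_single r, Finset.sum_eq_single s]
  · exact fun ν _ hν => by rw [h r ν, if_neg (fun h => hν h.2), zero_smul]
  · simp
  · exact fun μ _ hμ => Finset.sum_eq_zero fun ν _ => by
      rw [h μ ν, if_neg (fun h => hμ h.1), zero_smul]
  · simp

theorem ann_of_single {Φ : Matrix M K ℂ} {r : M} {s : K}
    (h : ∀ μ ν, Φ μ ν = if μ = r ∧ ν = s then Φ r s else 0) (x : V) :
    F.ann Φ x = star (Φ r s) • F.b s (F.a r x) := by
  rw [ann_apply, Finset.sum_eq_single r, Finset.sum_eq_single s]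
  · exact fun ν _ hν => by rw [h r ν, if_neg (fun h => hν h.2), star_zero, zero_smul]
  · simp
  · exact fun μ _ hμ => Finset.sum_eq_zero fun ν _ => by
      rw [h μ ν, if_neg (fun h => hμ h.1), star_zero, zero_smul]
  · simp

/-- The quasiboson state `A†_{γ₁} ⋯ A†_{γₙ} |O⟩`. -/
def state (Φ : ι → Matrix M K ℂ) (γ : List ι) : V := (γ.map fun α => F.cre (Φ α)).prod F.vac

theorem state_mem (Φ : ι → Matrix M K ℂ) (γ : List ι) : F.state Φ γ ∈ F.states Φ := ⟨γ, rfl⟩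

@[simp] theorem state_nil (Φ : ι → Matrix M K ℂ) : F.state Φ [] = F.vac := by simp [state]

@[simp] theorem state_cons (Φ : ι → Matrix M K ℂ) (α : ι) (γ : List ι) :
    F.state Φ (α :: γ) = F.cre (Φ α) (F.state Φ γ) := by
  simp [state]

theorem state_replicate (Φ : ι → Matrix M K ℂ) (α : ι) (n : ℕ) :
    F.state Φ (List.replicate n α) = (F.cre (Φ α) ^ n) F.vac := by
  simp [state]

section SingleEntry

variable {Φ : ι → Matrix M K ℂ} {F}

theorem cre_cre_of_isSingleEntry (hS : IsSingleEntry Φ) {α β : ι} (h : α ≠ β) (x : V) :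
    F.cre (Φ α) (F.cre (Φ β) x) = F.cre (Φ β) (F.cre (Φ α) x) := by
  obtain ⟨μ₀, ν₀, hμ, hν, he⟩ := hS
  simp only [F.cre_of_single (he _).2, map_smul]
  rw [smul_comm]
  congr 2
  simp only [F.adag_adag_ne (hμ.ne h), F.bdag_bdag_ne (hν.ne h), F.adag_bdag, map_neg, neg_neg]

theorem ann_cre_of_isSingleEntry (hS : IsSingleEntry Φ) {α β : ι} (h : α ≠ β) (x : V) :
    F.ann (Φ α) (F.cre (Φ β) x) = F.cre (Φ β) (F.ann (Φ α) x) := by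
  obtain ⟨μ₀, ν₀, hμ, hν, he⟩ := hS
  simp only [F.cre_of_single (he _).2, F.ann_of_single (he _).2, map_smul]
  rw [smul_comm]
  congr 2
  simp only [F.a_adag_ne (hμ.ne h), F.b_bdag_ne (hν.ne h), F.a_bdag_apply, F.adag_b, F.adag_bdag,
    map_neg, neg_neg]

theorem ann_ann_of_isSingleEntry (hS : IsSingleEntry Φ) {α β : ι} (h : α ≠ β) (x : V) :
    F.ann (Φ α) (F.ann (Φ β) x) = F.ann (Φ β) (F.ann (Φ α) x) :=
  ext_inner_right ℂ fun y => by simp only [inner_ann, cre_cre_of_isSingleEntry hS h]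

theorem state_perm (hS : IsSingleEntry Φ) {γ δ : List ι} (h : γ.Perm δ) :
    F.state Φ γ = F.state Φ δ := by
  induction h with
  | nil => rfl
  | cons α _ ih => rw [state_cons, state_cons, ih]
  | swap α β γ =>
    simp only [state_cons]
    by_cases h : β = α
    · rw [h]
    · exact cre_cre_of_isSingleEntry hS h _
  | trans _ _ ih ih' => exact ih.trans ih'

variable [DecidableEq ι]

/-- Creating a pair of other modes commutes with both occupation operators, while a pair of the same
modes changes each eigenvalue by the recursion `[n+1] = 1 - q[n]`. -/
theorem occupation_state (hq : q ≠ -1) {μ₀ : ι → M} {ν₀ : ι → K} (hμ : Function.Injective μ₀)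
    (hν : Function.Injective ν₀)
    (he : ∀ α μ ν, Φ α μ ν = if μ = μ₀ α ∧ ν = ν₀ α then Φ α (μ₀ α) (ν₀ α) else 0)
    (α : ι) (γ : List ι) :
    F.adag (μ₀ α) (F.a (μ₀ α) (F.state Φ γ)) = (qNum q (γ.count α) : ℂ) • F.state Φ γ ∧
      F.bdag (ν₀ α) (F.b (ν₀ α) (F.state Φ γ)) = (qNum q (γ.count α) : ℂ) • F.state Φ γ := by
  induction γ with
  | nil => simp [F.a_vac, F.b_vac, qNum_zero]
  | cons β γ ih =>
    simp only [state_cons, F.cre_of_single (he β), map_smul]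
    by_cases h : β = α
    · subst h
      rw [List.count_cons_self, qNum_succ_complex hq]
      constructor
      · simp only [F.a_adag_self, F.a_bdag_apply, F.adag_bdag, map_neg, map_sub, map_smul, ih.1]
        module
      -- The relation `a† b = -b a†` is used backwards, to bring `b` next to `b†`.
      · rw [← neg_neg (F.b _ _), ← F.adag_b, F.b_bdag_self, ih.2]
        simp only [map_sub, map_smul, map_neg, F.adag_bdag]
        module
    · rw [List.count_cons_of_ne h]
      have hμ' := hμ.ne h
      have hν' := hν.ne h
      constructor
      · simp only [F.a_adag_ne hμ'.symm, F.a_bdag_apply, F.adag_bdag, F.adag_adag_ne hμ'.symm,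
          map_neg, map_smul, ih.1]
        module
      · rw [← neg_neg (F.b _ _), ← F.adag_b, F.b_bdag_ne hν'.symm]
        simp only [map_neg, neg_neg]
        rw [← neg_neg (F.bdag _ (F.adag _ _)), ← F.adag_bdag, F.bdag_bdag_ne hν'.symm, ih.2]
        simp only [map_smul, map_neg, neg_neg, smul_comm (Φ β _ _)]

theorem ann_cre_state (hq : q ≠ -1) (hS : IsSingleEntry Φ) (α : ι) (γ : List ι) :
    F.ann (Φ α) (F.cre (Φ α) (F.state Φ γ)) =
      ((qNum q (γ.count α + 1) ^ 2 : ℝ) : ℂ) • F.state Φ γ := by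
  obtain ⟨μ₀, ν₀, hμ, hν, he⟩ := hS
  obtain ⟨h1, h2⟩ := occupation_state (F := F) hq hμ hν (fun α => (he α).2) α γ
  have hc : star (Φ α (μ₀ α) (ν₀ α)) * Φ α (μ₀ α) (ν₀ α) = 1 := by
    rw [RCLike.star_def, Complex.conj_mul', (he α).1]; simp
  have h3 : F.a (μ₀ α) (F.adag (μ₀ α) (F.state Φ γ)) =
      (qNum q (γ.count α + 1) : ℂ) • F.state Φ γ := by
    rw [F.a_adag_self, h1, qNum_succ_complex hq]; module
  have h4 : F.b (ν₀ α) (F.bdag (ν₀ α) (F.state Φ γ)) =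
      (qNum q (γ.count α + 1) : ℂ) • F.state Φ γ := by
    rw [F.b_bdag_self, h2, qNum_succ_complex hq]; module
  rw [F.cre_of_single (he α).2, F.ann_of_single (he α).2, map_smul, map_smul, smul_smul, hc,
    one_smul, F.adag_bdag, map_neg, F.a_bdag_apply, neg_neg, h3, map_smul, map_smul, h4,
    smul_smul]
  push_cast
  rw [sq]

theorem ann_cre_state_append_replicate (hq : q ≠ -1) (hS : IsSingleEntry Φ) (α β γ : ι)
    (j k : ℕ) : F.ann (Φ γ) (F.cre (Φ γ)
        (F.state Φ (List.replicate j α ++ List.replicate k β))) =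
      ((qNum q ((if α = γ then j else 0) + (if β = γ then k else 0) + 1) ^ 2 : ℝ) : ℂ) •
        F.state Φ (List.replicate j α ++ List.replicate k β) := by
  rw [ann_cre_state hq hS, List.count_append, List.count_replicate, List.count_replicate]
  simp only [beq_iff_eq]

theorem cre_ann_state (hq : q ≠ -1) (hS : IsSingleEntry Φ) (α : ι) (γ : List ι) :
    F.cre (Φ α) (F.ann (Φ α) (F.state Φ γ)) =
      ((qNum q (γ.count α) ^ 2 : ℝ) : ℂ) • F.state Φ γ := by
  obtain ⟨μ₀, ν₀, hμ, hν, he⟩ := hS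
  obtain ⟨h1, h2⟩ := occupation_state (F := F) hq hμ hν (fun α => (he α).2) α γ
  have hc : star (Φ α (μ₀ α) (ν₀ α)) * Φ α (μ₀ α) (ν₀ α) = 1 := by
    rw [RCLike.star_def, Complex.conj_mul', (he α).1]; simp
  rw [F.ann_of_single (he α).2, F.cre_of_single (he α).2, map_smul, map_smul, smul_smul,
    mul_comm, hc, one_smul, F.adag_bdag, F.adag_b, map_neg, neg_neg, h1, map_smul, map_smul, h2,
    smul_smul]
  push_cast
  rw [sq]

theorem state_ne_zero (hq : q < 1) (hq' : q ≠ -1) (hS : IsSingleEntry Φ) (γ : List ι) :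
    F.state Φ γ ≠ 0 := by
  induction γ with
  | nil => simpa using F.vac_ne_zero
  | cons α γ ih =>
    intro h
    have h1 := ann_cre_state (F := F) hq' hS α γ
    rw [← state_cons, h, map_zero] at h1
    refine smul_ne_zero ?_ ih h1.symm
    exact_mod_cast (pow_pos (qNum_succ_pos hq hq' _) 2).ne'

/-- `‖Aψ‖² = ⟨ψ, A†Aψ⟩`, and the eigenvalue of `A†A` is `[0]² = 0`. -/
theorem ann_state_of_notMem (hq : q ≠ -1) (hS : IsSingleEntry Φ) {α : ι} {γ : List ι}
    (h : α ∉ γ) : F.ann (Φ α) (F.state Φ γ) = 0 := by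
  have h1 := cre_ann_state (F := F) hq hS α γ
  rw [List.count_eq_zero_of_not_mem h, qNum_zero] at h1
  rw [← inner_self_eq_zero (𝕜 := ℂ), inner_ann, h1]
  simp

theorem ann_state_cons (hq : q ≠ -1) (hS : IsSingleEntry Φ) (α : ι) (γ : List ι) :
    F.ann (Φ α) (F.state Φ (α :: γ)) = ((qNum q (γ.count α + 1) ^ 2 : ℝ) : ℂ) • F.state Φ γ := by
  rw [state_cons, ann_cre_state hq hS]

/-- A creation operator moved to the other side either removes one copy of `α` there or annihilates
the state, which gives induction on the list. -/
theorem inner_state_of_not_perm (hq : q ≠ -1) (hS : IsSingleEntry Φ) {γ δ : List ι}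
    (h : ¬ γ.Perm δ) : inner ℂ (F.state Φ γ) (F.state Φ δ) = 0 := by
  induction γ generalizing δ with
  | nil =>
    cases δ with
    | nil => exact absurd (List.Perm.refl _) h
    | cons β δ => rw [state_nil, state_cons, ← inner_ann, ann_vac, inner_zero_left]
  | cons α γ ih =>
    rw [state_cons, inner_cre]
    by_cases hα : α ∈ δ
    · have hp := List.perm_cons_erase hα
      rw [state_perm hS hp, ann_state_cons hq hS, inner_smul_right, ih, mul_zero]
      exact fun h' => h ((h'.cons α).trans hp.symm)
    · rw [ann_state_of_notMem hq hS hα, inner_zero_right]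

/-- States depend only on the multiset of labels; those of distinct multisets are nonzero and
orthogonal, hence independent, so a diagonal action may be prescribed on their span and extended to
`V`. -/
theorem exists_number_operator (hq : q < 1) (hq' : q ≠ -1) (hS : IsSingleEntry Φ) (f : ℕ → ℂ)
    (α : ι) : ∃ N : Module.End ℂ V, ∀ γ, N (F.state Φ γ) = f (γ.count α) • F.state Φ γ := by
  let v : Multiset ι → V := fun s => F.state Φ s.toList
  have hv : LinearIndependent ℂ v := by
    refine linearIndependent_of_ne_zero_of_inner_eq_zero
      (fun s => state_ne_zero hq hq' hS _) fun s t hst => ?_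
    refine inner_state_of_not_perm hq' hS fun h => hst ?_
    rw [← Multiset.coe_toList s, ← Multiset.coe_toList t]
    exact Multiset.coe_eq_coe.mpr h
  obtain ⟨N, hN⟩ := ((Module.Basis.span hv).constr ℂ
    fun s => f (s.count α) • v s).exists_extend
  refine ⟨N, fun γ => ?_⟩
  have h1 : F.state Φ γ = v γ :=
    state_perm hS (Multiset.coe_eq_coe.mp (Multiset.coe_toList (γ : Multiset ι)).symm)
  have h2 := LinearMap.congr_fun hN (Module.Basis.span hv γ)
  rw [Module.Basis.constr_basis, LinearMap.comp_apply, Submodule.subtype_apply,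
    Module.Basis.span_apply] at h2
  rw [h1, h2, Multiset.coe_count]

/-- An operator diagonal on the states satisfies the number operator relations exactly when its
eigenvalues increase by one with each quasiboson. -/
theorem numberRel_iff (hq : q < 1) (hq' : q ≠ -1) (hS : IsSingleEntry Φ) {f : ℕ → ℂ} {α : ι}
    {N : Module.End ℂ V} (hN : ∀ γ, N (F.state Φ γ) = f (γ.count α) • F.state Φ γ) :
    F.NumberRel Φ N α ↔ ∀ n, f (n + 1) - f n = 1 := by
  have hcre : ∀ γ, ⁅N, F.cre (Φ α)⁆ (F.state Φ γ) =
      (f (γ.count α + 1) - f (γ.count α)) • F.cre (Φ α) (F.state Φ γ) := fun γ => by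
    rw [LieRing.of_associative_ring_bracket, LinearMap.sub_apply, Module.End.mul_apply,
      Module.End.mul_apply, ← state_cons, hN, hN, map_smul, ← state_cons, List.count_cons_self,
      sub_smul]
  constructor
  · rintro ⟨h, -⟩ n
    have h1 := h _ (F.state_mem Φ (List.replicate n α))
    rw [hcre, List.count_replicate_self, ← state_cons, ← sub_eq_zero] at h1
    nth_rw 2 [← one_smul ℂ (F.state Φ (α :: List.replicate n α))] at h1
    rw [← sub_smul] at h1
    exact sub_eq_zero.mp ((smul_eq_zero.mp h1).resolve_right (state_ne_zero hq hq' hS _))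
  · intro h
    refine ⟨?_, ?_⟩
    · rintro _ ⟨γ, rfl⟩
      refine (hcre γ).trans ?_
      rw [h, one_smul]
      rfl
    · rintro _ ⟨γ, rfl⟩
      change ⁅N, F.ann (Φ α)⁆ (F.state Φ γ) = (-F.ann (Φ α)) (F.state Φ γ)
      rw [LieRing.of_associative_ring_bracket, LinearMap.sub_apply, Module.End.mul_apply,
        Module.End.mul_apply, LinearMap.neg_apply, hN, map_smul]
      by_cases hα : α ∈ γ
      · rw [state_perm hS (List.perm_cons_erase hα), ann_state_cons hq' hS, map_smul, hN,
          List.count_erase_self]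
        have h1 : γ.count α = γ.count α - 1 + 1 :=
          (Nat.succ_pred_eq_of_pos (List.count_pos_iff.mpr hα)).symm
        have h2 := h (γ.count α - 1)
        rw [← h1] at h2 ⊢
        rw [eq_add_of_sub_eq h2]
        module
      · rw [ann_state_of_notMem hq' hS hα]
        simp

theorem commute_number_of_ne (hq : q ≠ -1) (hS : IsSingleEntry Φ) {f : ℕ → ℂ} {α β : ι}
    (h : α ≠ β) {N : Module.End ℂ V}
    (hN : ∀ γ, N (F.state Φ γ) = f (γ.count α) • F.state Φ γ) :
    F.WeakEq Φ ⁅N, F.cre (Φ β)⁆ 0 ∧ F.WeakEq Φ ⁅N, F.ann (Φ β)⁆ 0 := by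
  refine ⟨?_, ?_⟩
  · rintro _ ⟨γ, rfl⟩
    change ⁅N, F.cre (Φ β)⁆ (F.state Φ γ) = 0
    rw [LieRing.of_associative_ring_bracket, LinearMap.sub_apply, Module.End.mul_apply,
      Module.End.mul_apply, ← state_cons, hN, hN, map_smul, ← state_cons,
      List.count_cons_of_ne h.symm, sub_self]
  · rintro _ ⟨γ, rfl⟩
    change ⁅N, F.ann (Φ β)⁆ (F.state Φ γ) = 0
    rw [LieRing.of_associative_ring_bracket, LinearMap.sub_apply, Module.End.mul_apply,
      Module.End.mul_apply, hN, map_smul]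
    by_cases hβ : β ∈ γ
    · rw [state_perm hS (List.perm_cons_erase hβ), ann_state_cons hq hS, map_smul, hN,
        List.count_erase_of_ne h, smul_comm, sub_self]
    · rw [ann_state_of_notMem hq hS hβ]
      simp

theorem exists_isRealization (hq : q < 1) (hq' : q ≠ -1) (hS : IsSingleEntry Φ) {φ : ℝ → ℝ}
    (hφ : ∀ n : ℕ, φ n = qNum q n ^ 2) :
    ∃ N : ι → Module.End ℂ V, F.IsRealization Φ φ N ∧ ∀ α β, α ≠ β →
      F.WeakEq Φ ⁅N α, F.cre (Φ β)⁆ 0 ∧ F.WeakEq Φ ⁅N α, F.ann (Φ β)⁆ 0 := by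
  choose N hN using exists_number_operator (F := F) hq hq' hS fun n => (n : ℂ)
  refine ⟨N, ⟨fun α => ?_, fun α => ?_, fun α => ?_, fun α β h => ?_, fun α β h => ?_,
    fun α β h => ?_, fun α => ?_⟩, fun α β h => commute_number_of_ne hq' hS h (hN α)⟩
  · simpa using hN α []
  · rintro _ ⟨γ, rfl⟩
    refine Submodule.subset_span ⟨γ.count α, (hN α γ).trans (by simp; rfl), ?_⟩
    rw [hφ]
    exact cre_ann_state hq' hS α γ
  · rintro _ ⟨γ, rfl⟩
    refine Submodule.subset_span ⟨(γ.count α + 1 : ℕ), ?_, ?_⟩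
    · change N α (F.state Φ γ) + F.state Φ γ = _ • F.state Φ γ
      rw [hN]
      push_cast
      rw [add_smul, one_smul]
    · rw [hφ]
      exact ann_cre_state hq' hS α γ
  · rintro ψ -
    simp [LieRing.of_associative_ring_bracket, cre_cre_of_isSingleEntry hS h]
  · rintro ψ -
    simp [LieRing.of_associative_ring_bracket, ann_ann_of_isSingleEntry hS h]
  · rintro ψ -
    simp [LieRing.of_associative_ring_bracket, ann_cre_of_isSingleEntry hS h]
  · rw [numberRel_iff hq hq' hS (hN α)]
    intro n
    push_cast
    ring

theorem number_function_state (hq : q ≠ -1) (hS : IsSingleEntry Φ) {χ : ℝ → ℝ → ℝ} {α : ι}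
    {N : Module.End ℂ V}
    (hN : F.WeakEqFun₂ Φ N (F.cre (Φ α) * F.ann (Φ α)) (F.ann (Φ α) * F.cre (Φ α)) χ)
    (γ : List ι) :
    N (F.state Φ γ) = ((χ (qNum q (γ.count α) ^ 2) (qNum q (γ.count α + 1) ^ 2) : ℝ) : ℂ) •
      F.state Φ γ :=
  opFun₂_apply_eigenvector (hN _ (F.state_mem Φ γ)) (cre_ann_state hq hS α γ)
    (ann_cre_state hq hS α γ)

theorem exists_number_function (hq : q < 1) (hq' : q ≠ -1) (hS : IsSingleEntry Φ)
    (χ : ℝ → ℝ → ℝ) (α : ι) : ∃ N : Module.End ℂ V,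
      F.WeakEqFun₂ Φ N (F.cre (Φ α) * F.ann (Φ α)) (F.ann (Φ α) * F.cre (Φ α)) χ := by
  obtain ⟨N, hN⟩ := exists_number_operator (F := F) hq hq' hS
    (fun n => ((χ (qNum q n ^ 2) (qNum q (n + 1) ^ 2) : ℝ) : ℂ)) α
  refine ⟨N, ?_⟩
  rintro _ ⟨γ, rfl⟩
  exact Submodule.subset_span ⟨_, _, cre_ann_state hq' hS α γ, ann_cre_state hq' hS α γ, hN γ⟩

theorem numberRel_number_function_iff (hq : q < 1) (hq' : q ≠ -1) (hS : IsSingleEntry Φ)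
    {χ : ℝ → ℝ → ℝ} {α : ι} {N : Module.End ℂ V}
    (hN : F.WeakEqFun₂ Φ N (F.cre (Φ α) * F.ann (Φ α)) (F.ann (Φ α) * F.cre (Φ α)) χ) :
    F.NumberRel Φ N α ↔ ∀ n : ℕ,
      χ (qNum q (n + 1) ^ 2) (qNum q (n + 2) ^ 2) - χ (qNum q n ^ 2) (qNum q (n + 1) ^ 2) = 1 := by
  rw [numberRel_iff hq hq' hS
    (f := fun n => ((χ (qNum q n ^ 2) (qNum q (n + 1) ^ 2) : ℝ) : ℂ))
    (number_function_state hq' hS hN)]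
  norm_cast

end SingleEntry

end QFermionSystem

/-! ### Linear combinations of the `b_ν` and vectors supported on one row -/

namespace QFermionSystem

section Lowering

variable {q : ℝ} {M K V : Type*} [DecidableEq M] [Fintype K] [DecidableEq K]
  [NormedAddCommGroup V] [InnerProductSpace ℂ V] (F : QFermionSystem q M K V)

/-- The linear combination `∑ conj(c^ν) b_ν` of annihilation operators. -/
def low (c : K → ℂ) : Module.End ℂ V := ∑ ν, star (c ν) • F.b ν

theorem low_apply (c : K → ℂ) (x : V) : F.low c x = ∑ ν, star (c ν) • F.b ν x := by
  simp [low]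

theorem a_low (μ : M) (c : K → ℂ) (x : V) : F.a μ (F.low c x) = -F.low c (F.a μ x) := by
  simp only [low_apply, map_sum, map_smul, F.a_b_apply, smul_neg, Finset.sum_neg_distrib]

theorem adag_low (μ : M) (c : K → ℂ) (x : V) :
    F.adag μ (F.low c x) = -F.low c (F.adag μ x) := by
  simp only [low_apply, map_sum, map_smul, F.adag_b, smul_neg, Finset.sum_neg_distrib]

/-- Only the term with `b_ν` itself fails to anticommute, because `b_ν²` need not vanish. -/
theorem low_b (c : K → ℂ) (ν : K) (x : V) :
    F.low c (F.b ν x) = (2 * star (c ν)) • F.b ν (F.b ν x) - F.b ν (F.low c x) := by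
  rw [eq_sub_iff_add_eq]
  simp only [low_apply, map_sum, map_smul, ← Finset.sum_add_distrib]
  rw [Finset.sum_eq_single ν]
  · module
  · intro t _ ht
    rw [F.b_b_ne ht]
    module
  · simp

/-- In the square of `low c` the mixed terms cancel, leaving `∑ conj(c^ν)² b_ν²`, which commutes
with every `b_ν`. -/
theorem low_low_b (c : K → ℂ) (ν : K) (x : V) :
    F.low c (F.low c (F.b ν x)) = F.b ν (F.low c (F.low c x)) := by
  simp only [low_b, map_sub, map_smul]
  module

theorem low_low_low (c d : K → ℂ) (x : V) :
    F.low c (F.low c (F.low d x)) = F.low d (F.low c (F.low c x)) := by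
  simp only [F.low_apply d, map_sum, map_smul, low_low_b]

theorem low_bdag (c : K → ℂ) {ν : K} {x : V} (hx : F.b ν x = 0) :
    F.low c (F.bdag ν x) = star (c ν) • x - F.bdag ν (F.low c x) := by
  rw [eq_sub_iff_add_eq]
  simp only [low_apply, map_sum, map_smul, ← Finset.sum_add_distrib]
  rw [Finset.sum_eq_single ν]
  · rw [F.b_bdag_self, hx]
    simp
  · intro t _ ht
    rw [F.b_bdag_ne ht]
    module
  · simp

theorem b_low_eq_zero (c : K → ℂ) {ν : K} {x : V} (hx : F.b ν x = 0) :
    F.b ν (F.low c x) = 0 := by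
  have h := F.low_b c ν x
  rw [hx, map_zero, map_zero, smul_zero, zero_sub] at h
  exact neg_eq_zero.mp h.symm

theorem low_low_bdag (c : K → ℂ) {ν : K} {x : V} (hx : F.b ν x = 0) :
    F.low c (F.low c (F.bdag ν x)) = F.bdag ν (F.low c (F.low c x)) := by
  rw [F.low_bdag c hx, map_sub, map_smul, F.low_bdag c (F.b_low_eq_zero c hx)]
  module

/-- The commutator of two linear combinations of annihilation operators. -/
def lowComm (c d : K → ℂ) : Module.End ℂ V := F.low d * F.low c - F.low c * F.low d

theorem lowComm_apply (c d : K → ℂ) (x : V) :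
    F.lowComm c d x = F.low d (F.low c x) - F.low c (F.low d x) := rfl

theorem a_lowComm (μ : M) (c d : K → ℂ) (x : V) :
    F.a μ (F.lowComm c d x) = F.lowComm c d (F.a μ x) := by
  simp only [lowComm_apply, map_sub, a_low, map_neg, neg_neg]

theorem low_low_lowComm (c d : K → ℂ) (x : V) :
    F.low c (F.low c (F.lowComm c d x)) = F.lowComm c d (F.low c (F.low c x)) := by
  rw [lowComm_apply, lowComm_apply, map_sub, map_sub, F.low_low_low c d (F.low c x),
    F.low_low_low c d x]

end Lowering

section Powers

variable {q : ℝ} {M K V : Type*} [DecidableEq M] [DecidableEq K]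
  [NormedAddCommGroup V] [InnerProductSpace ℂ V] (F : QFermionSystem q M K V)

/-- The truncated exponent at `n = 0` is harmless, since `[0] = 0`; the same convention serves for
all lowered states below. -/
theorem a_adag_pow (hq : q ≠ -1) {μ : M} {x : V} (hx : F.a μ x = 0) (n : ℕ) :
    F.a μ ((F.adag μ ^ n) x) = (qNum q n : ℂ) • (F.adag μ ^ (n - 1)) x := by
  induction n with
  | zero => simp [hx, qNum_zero]
  | succ n ih =>
    rw [pow_succ', Module.End.mul_apply, F.a_adag_self, ih, qNum_succ_complex hq,
      Nat.add_sub_cancel]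
    cases n with
    | zero => simp [qNum_zero]
    | succ n =>
      rw [Nat.add_sub_cancel, map_smul, pow_succ', Module.End.mul_apply]
      module

theorem b_bdag_pow (hq : q ≠ -1) {ν : K} {x : V} (hx : F.b ν x = 0) (n : ℕ) :
    F.b ν ((F.bdag ν ^ n) x) = (qNum q n : ℂ) • (F.bdag ν ^ (n - 1)) x :=
  F.swap.a_adag_pow hq hx n

theorem a_adag_pow_ne {μ μ' : M} (h : μ ≠ μ') (n : ℕ) (x : V) :
    F.a μ ((F.adag μ' ^ n) x) = (-1 : ℂ) ^ n • (F.adag μ' ^ n) (F.a μ x) := by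
  induction n with
  | zero => simp
  | succ n ih =>
    rw [pow_succ', Module.End.mul_apply, F.a_adag_ne h, ih, map_smul, Module.End.mul_apply]
    module

theorem b_bdag_pow_ne {ν ν' : K} (h : ν ≠ ν') (n : ℕ) (x : V) :
    F.b ν ((F.bdag ν' ^ n) x) = (-1 : ℂ) ^ n • (F.bdag ν' ^ n) (F.b ν x) :=
  F.swap.a_adag_pow_ne h n x

theorem a_bdag_pow (μ : M) (ν : K) (n : ℕ) (x : V) :
    F.a μ ((F.bdag ν ^ n) x) = (-1 : ℂ) ^ n • (F.bdag ν ^ n) (F.a μ x) := by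
  induction n with
  | zero => simp
  | succ n ih =>
    rw [pow_succ', Module.End.mul_apply, F.a_bdag_apply, ih, map_smul, Module.End.mul_apply]
    module

theorem adag_bdag_pow (μ : M) (ν : K) (n : ℕ) (x : V) :
    F.adag μ ((F.bdag ν ^ n) x) = (-1 : ℂ) ^ n • (F.bdag ν ^ n) (F.adag μ x) := by
  induction n with
  | zero => simp
  | succ n ih =>
    rw [pow_succ', Module.End.mul_apply, F.adag_bdag, ih, map_smul, Module.End.mul_apply]
    module

theorem b_adag_pow (ν : K) (μ : M) (n : ℕ) (x : V) :
    F.b ν ((F.adag μ ^ n) x) = (-1 : ℂ) ^ n • (F.adag μ ^ n) (F.b ν x) :=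
  F.swap.a_bdag_pow ν μ n x

theorem bdag_bdag_pow_ne {ν ν' : K} (h : ν ≠ ν') (n : ℕ) (x : V) :
    F.bdag ν ((F.bdag ν' ^ n) x) = (-1 : ℂ) ^ n • (F.bdag ν' ^ n) (F.bdag ν x) := by
  induction n with
  | zero => simp
  | succ n ih =>
    rw [pow_succ', Module.End.mul_apply, F.bdag_bdag_ne h, ih, map_smul, Module.End.mul_apply]
    module

/-- The vector `(b†_s)^i (b†_t)^j (a†_r)^n |O⟩`. -/
def rowState (r : M) (s t : K) (n i j : ℕ) : V :=
  (F.bdag s ^ i) ((F.bdag t ^ j) ((F.adag r ^ n) F.vac))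

variable {r : M} {s t : K}

theorem a_rowState_ne {m : M} (h : m ≠ r) (n i j : ℕ) : F.a m (F.rowState r s t n i j) = 0 := by
  rw [rowState, F.a_bdag_pow, F.a_bdag_pow, F.a_adag_pow_ne h, F.a_vac]
  simp

theorem b_rowState_ne {u : K} (hs : u ≠ s) (ht : u ≠ t) (n i j : ℕ) :
    F.b u (F.rowState r s t n i j) = 0 := by
  rw [rowState, F.b_bdag_pow_ne hs, F.b_bdag_pow_ne ht, F.b_adag_pow, F.b_vac]
  simp

theorem a_rowState (hq : q ≠ -1) (n i j : ℕ) : F.a r (F.rowState r s t n i j) =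
    ((-1) ^ (i + j) * qNum q n : ℂ) • F.rowState r s t (n - 1) i j := by
  rw [rowState, F.a_bdag_pow, F.a_bdag_pow, F.a_adag_pow hq (F.a_vac r), rowState, map_smul,
    map_smul, map_smul, smul_smul, smul_smul, pow_add]

theorem b_rowState_left (hq : q ≠ -1) (hst : s ≠ t) (n i j : ℕ) :
    F.b s (F.rowState r s t n i j) = (qNum q i : ℂ) • F.rowState r s t n (i - 1) j := by
  refine F.b_bdag_pow hq ?_ i
  rw [F.b_bdag_pow_ne hst, F.b_adag_pow, F.b_vac]
  simp

theorem b_rowState_right (hq : q ≠ -1) (hst : s ≠ t) (n i j : ℕ) :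
    F.b t (F.rowState r s t n i j) =
      ((-1) ^ i * qNum q j : ℂ) • F.rowState r s t n i (j - 1) := by
  rw [rowState, F.b_bdag_pow_ne hst.symm, F.b_bdag_pow hq, map_smul, smul_smul]
  · rfl
  · rw [F.b_adag_pow, F.b_vac]
    simp

theorem bdag_rowState_left (n i j : ℕ) :
    F.bdag s (F.rowState r s t n i j) = F.rowState r s t n (i + 1) j := by
  rw [rowState, rowState, pow_succ', Module.End.mul_apply]

theorem bdag_rowState_right (hst : s ≠ t) (n i j : ℕ) :
    F.bdag t (F.rowState r s t n i j) = (-1 : ℂ) ^ i • F.rowState r s t n i (j + 1) := by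
  rw [rowState, F.bdag_bdag_pow_ne hst.symm, rowState, pow_succ' (F.bdag t), Module.End.mul_apply]

theorem adag_rowState (n i j : ℕ) : F.adag r (F.rowState r s t n i j) =
    (-1 : ℂ) ^ (i + j) • F.rowState r s t (n + 1) i j := by
  rw [rowState, F.adag_bdag_pow, F.adag_bdag_pow, rowState, pow_succ' (F.adag r),
    Module.End.mul_apply, map_smul, smul_smul, pow_add]

theorem low_rowState [Fintype K] (hq : q ≠ -1) (hst : s ≠ t) (c : K → ℂ) (n i j : ℕ) :
    F.low c (F.rowState r s t n i j) =
      (star (c s) * qNum q i : ℂ) • F.rowState r s t n (i - 1) j +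
        (star (c t) * ((-1) ^ i * qNum q j) : ℂ) • F.rowState r s t n i (j - 1) := by
  rw [low_apply, ← Finset.add_sum_erase _ _ (Finset.mem_univ s),
    ← Finset.add_sum_erase _ _ (Finset.mem_erase.mpr ⟨hst.symm, Finset.mem_univ t⟩),
    Finset.sum_eq_zero, F.b_rowState_left hq hst, F.b_rowState_right hq hst, add_zero, smul_smul,
    smul_smul]
  intro u hu
  rw [F.b_rowState_ne (Finset.ne_of_mem_erase (Finset.mem_of_mem_erase hu))
    (Finset.ne_of_mem_erase hu), smul_zero]

theorem low_low_rowState [Fintype K] (hq : q ≠ -1) (hst : s ≠ t) (c : K → ℂ) (n i j : ℕ) :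
    F.low c (F.low c (F.rowState r s t n i j)) =
      (star (c s) ^ 2 * (qNum q i * qNum q (i - 1)) : ℂ) • F.rowState r s t n (i - 2) j +
        (star (c t) ^ 2 * (qNum q j * qNum q (j - 1)) : ℂ) • F.rowState r s t n i (j - 2) := by
  rw [F.low_rowState hq hst, map_add, map_smul, map_smul, F.low_rowState hq hst,
    F.low_rowState hq hst, Nat.sub_sub, Nat.sub_sub]
  have h : (-1 : ℂ) ^ i * (-1) ^ i = 1 := by rw [← mul_pow]; simp
  cases i with
  | zero =>
    simp only [qNum_zero]
    match_scalars <;> (norm_num; try ring)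
  | succ i =>
    simp only [Nat.add_sub_cancel] at h ⊢
    match_scalars
    · ring
    · rw [pow_succ]
      ring
    · linear_combination (star (c t) ^ 2 * (qNum q j * qNum q (j - 1)) : ℂ) * h

/-- Both factors can only remove a quantum of `s`, so the two orders give the same scalar. -/
theorem lowComm_rowState_left [Fintype K] (hq : q ≠ -1) (hst : s ≠ t) (c d : K → ℂ) :
    F.lowComm c d (F.a r (F.rowState r s t 1 2 0)) = 0 := by
  rw [F.a_rowState hq, map_smul, lowComm_apply]
  simp only [F.low_rowState hq hst, map_add, map_smul, qNum_zero, qNum_one hq]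
  match_scalars <;> (norm_num; try ring)

theorem lowComm_rowState_right [Fintype K] (hq : q ≠ -1) (hst : s ≠ t) (c d : K → ℂ) :
    F.lowComm c d (F.a r (F.rowState r s t 1 0 2)) = 0 := by
  rw [F.a_rowState hq, map_smul, lowComm_apply]
  simp only [F.low_rowState hq hst, map_add, map_smul, qNum_zero, qNum_one hq]
  match_scalars <;> (norm_num; try ring)

end Powers

end QFermionSystem

/-! ### Powers of `A` on one row -/

namespace QFermionSystem

variable {q : ℝ} {M K V : Type*} [Fintype M] [DecidableEq M] [Fintype K] [DecidableEq K]
  [NormedAddCommGroup V] [InnerProductSpace ℂ V] (F : QFermionSystem q M K V)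

theorem ann_eq_sum_low (Φ : Matrix M K ℂ) (x : V) :
    F.ann Φ x = ∑ μ, F.low (Φ μ) (F.a μ x) := by
  simp only [ann_apply, low_apply]

/-- The eigenvector-type hypothesis in weak form: pair it with `x` and move every operator to the
other side. -/
theorem inner_vac_ann_pow (Φ : Matrix M K ℂ) (x : V) (n : ℕ) {c : ℂ}
    (h : F.ann Φ ((F.cre Φ ^ (n + 1)) F.vac) = c • (F.cre Φ ^ n) F.vac) :
    star c * inner ℂ F.vac ((F.ann Φ ^ n) x) =
      inner ℂ F.vac ((F.ann Φ ^ (n + 1)) (F.cre Φ x)) := by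
  rw [← inner_cre_pow, ← inner_cre_pow, ← inner_ann, h, inner_smul_left]
  rfl

section Row

variable {F} {Φ : Matrix M K ℂ} {r : M}

theorem ann_of_row {x : V} (hx : ∀ m, m ≠ r → F.a m x = 0) :
    F.ann Φ x = F.low (Φ r) (F.a r x) := by
  rw [ann_eq_sum_low, Finset.sum_eq_single r]
  · exact fun m _ hm => by rw [hx m hm, map_zero]
  · simp

theorem a_ann_of_row {x : V} (hx : ∀ m, m ≠ r → F.a m x = 0) {m : M} (hm : m ≠ r) :
    F.a m (F.ann Φ x) = 0 := by
  rw [ann_of_row hx, F.a_low, F.a_a_ne hm, hx m hm]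
  simp

theorem ann_ann_of_row {x : V} (hx : ∀ m, m ≠ r → F.a m x = 0) :
    F.ann Φ (F.ann Φ x) = -F.low (Φ r) (F.low (Φ r) (F.a r (F.a r x))) := by
  rw [ann_of_row fun m hm => a_ann_of_row hx hm, ann_of_row hx, F.a_low, map_neg]

theorem ann_adag_of_row {x : V} (hx : ∀ m, m ≠ r → F.a m x = 0) {m : M} (hm : m ≠ r) :
    F.ann Φ (F.adag m x) = F.low (Φ m) x + F.adag m (F.ann Φ x) := by
  rw [ann_eq_sum_low, ← Finset.add_sum_erase _ _ (Finset.mem_univ m),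
    ← Finset.add_sum_erase _ _ (Finset.mem_erase.mpr ⟨hm.symm, Finset.mem_univ r⟩),
    Finset.sum_eq_zero, F.a_adag_self, hx m hm, F.a_adag_ne hm.symm, ann_of_row hx, F.adag_low]
  · simp
  · intro u hu
    rw [F.a_adag_ne (Finset.ne_of_mem_erase (Finset.mem_of_mem_erase hu)),
      hx u (Finset.ne_of_mem_erase hu)]
    simp

/-- A quantum in a foreign row `m` can be removed by the first or the second `A`; the two
contributions have opposite signs and combine into a commutator. -/
theorem ann_ann_adag_of_row {x : V} (hx : ∀ m, m ≠ r → F.a m x = 0) {m : M} (hm : m ≠ r) :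
    F.ann Φ (F.ann Φ (F.adag m x)) =
      F.lowComm (Φ r) (Φ m) (F.a r x) + F.adag m (F.ann Φ (F.ann Φ x)) := by
  have h : ∀ u, u ≠ r → F.a u (F.low (Φ m) x) = 0 := fun u hu => by
    rw [F.a_low, hx u hu, map_zero, neg_zero]
  rw [ann_adag_of_row hx hm, map_add, ann_of_row h,
    ann_adag_of_row (fun u hu => a_ann_of_row hx hu) hm, F.a_low, ann_of_row hx, map_neg,
    lowComm_apply]
  abel

theorem ann_ann_lowComm_of_row {x : V} (hx : ∀ m, m ≠ r → F.a m x = 0) (m : M) :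
    F.ann Φ (F.ann Φ (F.lowComm (Φ r) (Φ m) (F.a r x))) =
      F.lowComm (Φ r) (Φ m) (F.a r (F.ann Φ (F.ann Φ x))) := by
  have h : ∀ u, u ≠ r → F.a u (F.lowComm (Φ r) (Φ m) (F.a r x)) = 0 := fun u hu => by
    rw [F.a_lowComm, F.a_a_ne hu, hx u hu]
    simp
  rw [ann_ann_of_row h, ann_ann_of_row hx]
  simp only [a_lowComm, low_low_lowComm, map_neg, a_low, neg_neg]

/-- Here `A²` is `-low² a_r²`, and `low²` contains `b_u` only through `b_u²`, which cannot act on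
the single quantum of mode `u`. -/
theorem ann_ann_bdag_of_row {x : V} (hx : ∀ m, m ≠ r → F.a m x = 0) {u : K}
    (hu : F.b u x = 0) : F.ann Φ (F.ann Φ (F.bdag u x)) = F.bdag u (F.ann Φ (F.ann Φ x)) := by
  have h : ∀ m, m ≠ r → F.a m (F.bdag u x) = 0 := fun m hm => by
    rw [F.a_bdag_apply, hx m hm, map_zero, neg_zero]
  have h' : F.b u (F.a r (F.a r x)) = 0 := by
    rw [← neg_neg (F.b u _), ← F.a_b_apply, ← map_neg, ← F.a_b_apply, hu]
    simp
  rw [ann_ann_of_row h, ann_ann_of_row hx, F.a_bdag_apply, map_neg, F.a_bdag_apply, neg_neg,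
    F.low_low_bdag _ h', map_neg]

theorem b_ann_ann_of_row {x : V} (hx : ∀ m, m ≠ r → F.a m x = 0) {u : K}
    (hu : F.b u x = 0) : F.b u (F.ann Φ (F.ann Φ x)) = 0 := by
  have h' : F.b u (F.a r (F.a r x)) = 0 := by
    rw [← neg_neg (F.b u _), ← F.a_b_apply, ← map_neg, ← F.a_b_apply, hu]
    simp
  rw [ann_ann_of_row hx, map_neg, ← low_low_b, h']
  simp

variable {s t : K}

/-- `A²` removes two quanta from the same column, `s` or `t`, so the parities of `i` and `j`
persist. This is what makes the test vectors tractable. -/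
theorem ann_ann_rowState (hq : q ≠ -1) (hst : s ≠ t) (n i j : ℕ) :
    F.ann Φ (F.ann Φ (F.rowState r s t n i j)) =
      (-(qNum q n * qNum q (n - 1)) * (star (Φ r s) ^ 2 * (qNum q i * qNum q (i - 1))) : ℂ) •
          F.rowState r s t (n - 2) (i - 2) j +
        (-(qNum q n * qNum q (n - 1)) * (star (Φ r t) ^ 2 * (qNum q j * qNum q (j - 1))) : ℂ) •
          F.rowState r s t (n - 2) i (j - 2) := by
  have h : (-1 : ℂ) ^ (i + j) * (-1) ^ (i + j) = 1 := by rw [← mul_pow]; simp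
  rw [ann_ann_of_row fun m hm => F.a_rowState_ne hm n i j, F.a_rowState hq, map_smul,
    F.a_rowState hq, smul_smul, Nat.sub_sub, map_smul, map_smul, F.low_low_rowState hq hst,
    mul_mul_mul_comm, h]
  module

/-- The foreign quantum must be removed by one of the three factors `A²`. The resulting commutator
term passes through the other factors, whence the `3`. -/
theorem inner_vac_ann_pow_six_adag {x : V} (hx : ∀ m, m ≠ r → F.a m x = 0) {m : M}
    (hm : m ≠ r) : inner ℂ F.vac ((F.ann Φ ^ 6) (F.adag m x)) =
      3 * inner ℂ F.vac (F.lowComm (Φ r) (Φ m) (F.a r ((F.ann Φ ^ 4) x))) := by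
  have h1 : ∀ u, u ≠ r → F.a u (F.ann Φ (F.ann Φ x)) = 0 := fun u hu =>
    a_ann_of_row (fun u hu => a_ann_of_row hx hu) hu
  have h2 : ∀ u, u ≠ r → F.a u (F.ann Φ (F.ann Φ (F.ann Φ (F.ann Φ x)))) = 0 := fun u hu =>
    a_ann_of_row (fun u hu => a_ann_of_row h1 hu) hu
  simp only [pow_succ, pow_zero, one_mul, Module.End.mul_apply]
  rw [ann_ann_adag_of_row hx hm, map_add, map_add, ann_ann_lowComm_of_row hx,
    ann_ann_adag_of_row h1 hm, map_add, map_add, map_add, map_add, ann_ann_lowComm_of_row h1,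
    ann_ann_adag_of_row h2 hm, inner_add_right, inner_add_right, inner_add_right,
    ← inner_a F m, F.a_vac, inner_zero_left]
  ring

/-- The vacuum component of `A⁶ A† w` for a vector `w` that involves one row of `Φ` only. -/
theorem inner_vac_ann_pow_six_cre (hq : q ≠ -1) (hst : s ≠ t) {w : V} {C X n c₁ c₂ : ℂ}
    (hw : ∀ m, m ≠ r → F.a m w = 0) (hb : ∀ u, u ≠ s → u ≠ t → F.b u w = 0)
    (h : (F.ann Φ ^ 4) w = C • F.rowState r s t 1 0 1)
    (hs : (F.ann Φ ^ 4) (F.bdag s w) = (C * n) • F.rowState r s t 1 1 1)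
    (ht : (F.ann Φ ^ 4) (F.bdag t w) =
      c₁ • F.rowState r s t 1 2 0 + c₂ • F.rowState r s t 1 0 2)
    (hrs : (F.ann Φ ^ 6) (F.adag r (F.bdag s w)) = 0)
    (hrt : (F.ann Φ ^ 6) (F.adag r (F.bdag t w)) = (C * X) • F.vac) :
    inner ℂ F.vac ((F.ann Φ ^ 6) (F.cre Φ w)) = C * (X * Φ r t +
      n * (∑ m, ∑ u, Φ m u * if m ≠ r ∧ u = s then
        3 * inner ℂ F.vac (F.lowComm (Φ r) (Φ m) (F.a r (F.rowState r s t 1 1 1))) else 0) +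
      ∑ m, ∑ u, Φ m u * if m ≠ r ∧ u ≠ s ∧ u ≠ t then 3 * inner ℂ F.vac
        (F.lowComm (Φ r) (Φ m) (F.a r (F.bdag u (F.rowState r s t 1 0 1)))) else 0) := by
  have hbd : ∀ u m, m ≠ r → F.a m (F.bdag u w) = 0 := fun u m hm => by
    rw [F.a_bdag_apply, hw m hm, map_zero, neg_zero]
  have hX : X * Φ r t = ∑ m, ∑ u, Φ m u * if m = r ∧ u = t then X else 0 := by
    rw [Finset.sum_eq_single r, Finset.sum_eq_single t]
    · simp [mul_comm]
    · exact fun u _ hu => by simp [hu]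
    · simp
    · exact fun m _ hm => by simp [hm]
    · simp
  rw [hX]
  simp only [cre_apply, map_sum, map_smul, inner_sum, inner_smul_right, Finset.mul_sum,
    ← Finset.sum_add_distrib]
  refine Finset.sum_congr rfl fun m _ => Finset.sum_congr rfl fun u _ => ?_
  by_cases hm : m = r
  · subst hm
    by_cases hus : u = s
    · subst hus
      simp [hrs, hst]
    by_cases hut : u = t
    · subst hut
      rw [hrt, inner_smul_right, F.inner_vac_vac]
      simp [hus]
      ring
    -- A lone quantum in a third column of row `r` survives all three factors `A²`, so there is no
    -- vacuum component.
    · have h1 : ∀ v, v ≠ m → F.a v (F.adag m w) = 0 := fun v hv => by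
        rw [F.a_adag_ne hv, hw v hv, map_zero, neg_zero]
      have h2 : F.b u (F.adag m w) = 0 := by
        rw [← neg_neg (F.b u _), ← F.adag_b, hb u hus hut]
        simp
      have h3 : ∀ v, v ≠ m → F.a v (F.ann Φ (F.ann Φ (F.adag m w))) = 0 := fun v hv =>
        a_ann_of_row (fun v hv => a_ann_of_row h1 hv) hv
      have h4 : ∀ v, v ≠ m →
          F.a v (F.ann Φ (F.ann Φ (F.ann Φ (F.ann Φ (F.adag m w))))) = 0 := fun v hv =>
        a_ann_of_row (fun v hv => a_ann_of_row h3 hv) hv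
      have h5 : inner ℂ F.vac ((F.ann Φ ^ 6) (F.adag m (F.bdag u w))) = (0 : ℂ) := by
        rw [F.adag_bdag, map_neg]
        simp only [pow_succ, pow_zero, one_mul, Module.End.mul_apply]
        rw [ann_ann_bdag_of_row h1 h2, ann_ann_bdag_of_row h3 (b_ann_ann_of_row h1 h2),
          ann_ann_bdag_of_row h4 (b_ann_ann_of_row h3 (b_ann_ann_of_row h1 h2)), inner_neg_right,
          inner_vac_bdag, neg_zero]
      rw [h5]
      simp [hut]
  · rw [inner_vac_ann_pow_six_adag (hbd u) hm]
    by_cases hus : u = s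
    · subst hus
      rw [hs]
      simp [hm]
      ring
    by_cases hut : u = t
    · subst hut
      -- With a foreign row and column `t`, only doubly occupied columns remain, and the commutator
      -- kills those.
      rw [ht, map_add, map_add, map_smul, map_smul, map_smul, map_smul,
        F.lowComm_rowState_left hq hst, F.lowComm_rowState_right hq hst]
      simp [hm, hus]
    · have h3 : ∀ v, v ≠ r → F.a v (F.ann Φ (F.ann Φ w)) = 0 := fun v hv =>
        a_ann_of_row (fun v hv => a_ann_of_row hw hv) hv
      have h5 : (F.ann Φ ^ 4) (F.bdag u w) = C • F.bdag u (F.rowState r s t 1 0 1) := by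
        rw [← map_smul, ← h]
        simp only [pow_succ, pow_zero, one_mul, Module.End.mul_apply]
        rw [ann_ann_bdag_of_row hw (hb u hus hut),
          ann_ann_bdag_of_row h3 (b_ann_ann_of_row hw (hb u hus hut))]
      rw [h5]
      simp [hm, hus, hut]
      ring

end Row

end QFermionSystem

/-! ### At most one nonzero entry in each row and column -/

namespace QFermionSystem

variable {q : ℝ} {M K V : Type*} [Fintype M] [DecidableEq M] [Fintype K] [DecidableEq K]
  [NormedAddCommGroup V] [InnerProductSpace ℂ V] {F : QFermionSystem q M K V}

/-- If `A (A†)⁶ |O⟩` is a multiple of `(A†)⁵ |O⟩`, every row of `Φ` has at most one nonzero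
entry. -/
theorem row_unique (hq : q < 1) (hq' : q ≠ -1) {Φ : Matrix M K ℂ} {c : ℂ}
    (h : F.ann Φ ((F.cre Φ ^ 6) F.vac) = c • (F.cre Φ ^ 5) F.vac) {r : M} {s t : K}
    (hs : Φ r s ≠ 0) (ht : Φ r t ≠ 0) : s = t := by
  by_contra hst
  have hβ : star (Φ r t) ≠ 0 := star_ne_zero.mpr ht
  have hQ : ∀ n, (qNum q (n + 1) : ℂ) ≠ 0 := fun n =>
    Complex.ofReal_ne_zero.mpr (qNum_succ_pos hq hq' n).ne'
  have e4 : ∀ x, (F.ann Φ ^ 4) x = F.ann Φ (F.ann Φ (F.ann Φ (F.ann Φ x))) := fun x => rfl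
  have e6 : ∀ x, (F.ann Φ ^ 6) x =
      F.ann Φ (F.ann Φ (F.ann Φ (F.ann Φ (F.ann Φ (F.ann Φ x))))) := fun x => rfl
  -- `P` and `E` collect the foreign rows, in column `s` and in the columns other than `s` and `t`.
  -- Like `κ`, they do not depend on the test vector.
  obtain ⟨P, hP⟩ : ∃ P, P = ∑ m, ∑ u, Φ m u * if m ≠ r ∧ u = s then
    3 * inner ℂ F.vac (F.lowComm (Φ r) (Φ m) (F.a r (F.rowState r s t 1 1 1))) else 0 := ⟨_, rfl⟩
  obtain ⟨E, hE⟩ : ∃ E, E = ∑ m, ∑ u, Φ m u * if m ≠ r ∧ u ≠ s ∧ u ≠ t then 3 * inner ℂ F.vac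
    (F.lowComm (Φ r) (Φ m) (F.a r (F.bdag u (F.rowState r s t 1 0 1)))) else 0 := ⟨_, rfl⟩
  obtain ⟨κ, hκ⟩ : ∃ κ, κ = star c * inner ℂ F.vac (F.ann Φ (F.rowState r s t 1 0 1)) :=
    ⟨_, rfl⟩
  -- `C` is the common factor by which `A⁴` maps the test vector to `rowState r s t 1 0 1`; it is
  -- divided out. For `i` even and `j` odd, adding a quantum in column `s` of row `r` makes both
  -- parities odd and contributes nothing.
  have key : ∀ {i j : ℕ} {C X n c₁ c₂ : ℂ}, Even i → Odd j → C ≠ 0 →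
      (F.ann Φ ^ 4) (F.rowState r s t 5 i j) = C • F.rowState r s t 1 0 1 →
      (F.ann Φ ^ 4) (F.rowState r s t 5 (i + 1) j) = (C * n) • F.rowState r s t 1 1 1 →
      (F.ann Φ ^ 4) (F.rowState r s t 5 i (j + 1)) =
        c₁ • F.rowState r s t 1 2 0 + c₂ • F.rowState r s t 1 0 2 →
      (F.ann Φ ^ 6) (F.rowState r s t 6 (i + 1) j) = 0 →
      (F.ann Φ ^ 6) (F.rowState r s t 6 i (j + 1)) = (C * X) • F.rowState r s t 0 0 0 →
      κ = X * Φ r t + n * P + E := by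
    intro i j C X n c₁ c₂ hi hj hC h1 h2 h3 h4 h5
    rw [hκ]
    have h6 := F.inner_vac_ann_pow Φ (F.rowState r s t 5 i j) 5 h
    rw [inner_vac_ann_pow_six_cre (s := s) (t := t) hq' hst
      (fun m hm => F.a_rowState_ne hm 5 i j) (fun u hu hv => F.b_rowState_ne hu hv 5 i j) h1
      (by rw [F.bdag_rowState_left]; exact h2)
      (by rw [F.bdag_rowState_right hst, hi.neg_one_pow, one_smul]; exact h3)
      (by rw [F.bdag_rowState_left, F.adag_rowState, map_smul, h4, smul_zero])
      (X := X) (by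
        rw [F.bdag_rowState_right hst, hi.neg_one_pow, one_smul, F.adag_rowState,
          (hi.add hj.add_one).neg_one_pow, one_smul]
        exact h5), pow_succ', Module.End.mul_apply, h1, map_smul, inner_smul_right, ← hP,
      ← hE] at h6
    refine mul_left_cancel₀ hC ?_
    linear_combination h6
  have k0 : κ = -(qNum q 6 * star (Φ r t) ^ 2 * qNum q 6) * Φ r t + 1 * P + E := by
    refine key (i := 0) (j := 5)
      (C := qNum q 5 * qNum q 4 * qNum q 3 * qNum q 2 * (star (Φ r t) ^ 4 * (qNum q 5 * qNum q 4 * qNum q 3 * qNum q 2)))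
      (c₁ := qNum q 5 * qNum q 4 * qNum q 3 * qNum q 2 * 0)
      (c₂ := qNum q 5 * qNum q 4 * qNum q 3 * qNum q 2 * (star (Φ r t) ^ 4 * (qNum q 6 * qNum q 5 * qNum q 4 * qNum q 3)))
      (by decide) (by decide) (by simp [hQ, ht]) ?_ ?_ ?_ ?_ ?_ <;>
    simp only [e4, e6, ann_ann_rowState hq' hst, map_smul, Nat.reduceSub, Nat.reduceAdd,
      qNum_zero, qNum_one hq', Complex.ofReal_zero, Complex.ofReal_one, mul_zero,
      zero_smul, smul_zero, add_zero, zero_add] <;>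
    module
  -- The `3 / 2` compares orders of removing pairs: three for `A⁶` on `(2, 4)` against two for `A⁴`
  -- on `(2, 3)`. In the other two equations the ratios are `1` and `3`.
  have k1 : κ = -(qNum q 6 * star (Φ r t) ^ 2 * (3 / 2 * qNum q 4)) * Φ r t + qNum q 3 * P + E := by
    refine key (i := 2) (j := 3)
      (C := qNum q 5 * qNum q 4 * qNum q 3 * qNum q 2 * (2 * star (Φ r s) ^ 2 * star (Φ r t) ^ 2 * (qNum q 2 * qNum q 3 * qNum q 2)))
      (c₁ := qNum q 5 * qNum q 4 * qNum q 3 * qNum q 2 * (star (Φ r t) ^ 4 * (qNum q 4 * qNum q 3 * qNum q 2)))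
      (c₂ := qNum q 5 * qNum q 4 * qNum q 3 * qNum q 2 * (2 * star (Φ r s) ^ 2 * star (Φ r t) ^ 2 * (qNum q 2 * qNum q 4 * qNum q 3)))
      (by decide) (by decide) (by simp [hQ, hs, ht]) ?_ ?_ ?_ ?_ ?_ <;>
    simp only [e4, e6, ann_ann_rowState hq' hst, map_add, map_smul, Nat.reduceSub, Nat.reduceAdd,
      qNum_zero, qNum_one hq', Complex.ofReal_zero, Complex.ofReal_one, mul_zero,
      zero_smul, smul_zero, add_zero, zero_add] <;>
    module
  have k2 : κ = -(qNum q 6 * star (Φ r t) ^ 2 * (3 * qNum q 2)) * Φ r t + qNum q 5 * P + E := by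
    refine key (i := 4) (j := 1)
      (C := qNum q 5 * qNum q 4 * qNum q 3 * qNum q 2 * (star (Φ r s) ^ 4 * (qNum q 4 * qNum q 3 * qNum q 2)))
      (c₁ := qNum q 5 * qNum q 4 * qNum q 3 * qNum q 2 * (2 * star (Φ r s) ^ 2 * star (Φ r t) ^ 2 * (qNum q 4 * qNum q 3 * qNum q 2)))
      (c₂ := qNum q 5 * qNum q 4 * qNum q 3 * qNum q 2 * (star (Φ r s) ^ 4 * (qNum q 4 * qNum q 3 * qNum q 2)))
      (by decide) (by decide) (by simp [hQ, hs]) ?_ ?_ ?_ ?_ ?_ <;>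
    simp only [e4, e6, ann_ann_rowState hq' hst, map_add, map_smul, Nat.reduceSub, Nat.reduceAdd,
      qNum_zero, qNum_one hq', Complex.ofReal_zero, Complex.ofReal_one, mul_zero,
      zero_smul, smul_zero, add_zero, zero_add] <;>
    module
  obtain ⟨G, hG⟩ : ∃ G : ℂ, G = qNum q 6 * star (Φ r t) ^ 2 * Φ r t := ⟨_, rfl⟩
  have hG0 : G ≠ 0 := by rw [hG]; exact mul_ne_zero (mul_ne_zero (hQ 5) (pow_ne_zero 2 hβ)) ht
  -- Differences remove `κ` and `E`; eliminating `P` then leaves a condition on `q` alone.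
  have e1 : G * (qNum q 6 - 3 / 2 * qNum q 4) = P * (1 - qNum q 3) := by
    rw [hG]; linear_combination k0 - k1
  have e2 : G * (qNum q 6 - 3 * qNum q 2) = P * (1 - qNum q 5) := by
    rw [hG]; linear_combination k0 - k2
  have e3 : G * ((qNum q 6 - 3 / 2 * qNum q 4) * (1 - qNum q 5) -
      (qNum q 6 - 3 * qNum q 2) * (1 - qNum q 3)) = 0 := by
    linear_combination (1 - qNum q 5 : ℂ) * e1 - (1 - qNum q 3 : ℂ) * e2
  have e4' := (mul_eq_zero.mp e3).resolve_left hG0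
  have q2 : qNum q 2 = 1 - q := by rw [qNum_succ hq', qNum_one hq']; ring
  have q3 : qNum q 3 = 1 - q + q ^ 2 := by rw [qNum_succ hq', q2]; ring
  have q4 : qNum q 4 = 1 - q + q ^ 2 - q ^ 3 := by rw [qNum_succ hq', q3]; ring
  have q5 : qNum q 5 = 1 - q + q ^ 2 - q ^ 3 + q ^ 4 := by rw [qNum_succ hq', q4]; ring
  have q6 : qNum q 6 = 1 - q + q ^ 2 - q ^ 3 + q ^ 4 - q ^ 5 := by rw [qNum_succ hq', q5]; ring
  have e5 : (qNum q 6 - 3 / 2 * qNum q 4) * (1 - qNum q 5) -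
      (qNum q 6 - 3 * qNum q 2) * (1 - qNum q 3) = 0 :=
    Complex.ofReal_injective (by push_cast; exact e4')
  have e6' : q * ((1 - q) ^ 4 * (q + 1) ^ 2 * (2 * q ^ 2 + 3)) = 0 := by
    rw [q2, q3, q4, q5, q6] at e5
    linear_combination 2 * e5
  have h1q : 1 - q ≠ 0 := by linarith
  have h2q : q + 1 ≠ 0 := fun h => hq' (by linarith)
  have hq0 : q = 0 := (mul_eq_zero.mp e6').resolve_right
    (mul_ne_zero (mul_ne_zero (pow_ne_zero 4 h1q) (pow_ne_zero 2 h2q)) (by positivity))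
  -- At `q = 0` all the `[n]` with `n ≥ 1` equal one, so `e1` reads `-G / 2 = 0`.
  rw [q6, q4, q3, hq0] at e1
  norm_num at e1
  exact hG0 e1

/-- If `A (A†)⁶ |O⟩` is a multiple of `(A†)⁵ |O⟩`, every column of `Φ` has at most one nonzero
entry. -/
theorem column_unique (hq : q < 1) (hq' : q ≠ -1) {Φ : Matrix M K ℂ} {c : ℂ}
    (h : F.ann Φ ((F.cre Φ ^ 6) F.vac) = c • (F.cre Φ ^ 5) F.vac) {r m : M} {s : K}
    (hr : Φ r s ≠ 0) (hm : Φ m s ≠ 0) : r = m := by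
  refine row_unique (F := F.swap) (Φ := Φ.transpose) (c := c) hq hq' ?_ hr hm
  -- Exchanging the families negates `A` and `A†`; both sides of the hypothesis acquire one overall
  -- sign.
  rw [ann_swap, cre_swap, Even.neg_pow (by decide), Odd.neg_pow (by decide), LinearMap.neg_apply,
    LinearMap.neg_apply, smul_neg]
  exact congrArg _ h

end QFermionSystem

/-! ### Decomposition of `Φ` into its nonzero entries -/

section EntryFamily

variable {M K : Type*} [DecidableEq M] [DecidableEq K]

/-- The matrix units at the positions of the nonzero entries of `Φ`. -/
def entryFamily (Φ : Matrix M K ℂ) : {e : M × K // Φ e.1 e.2 ≠ 0} → Matrix M K ℂ :=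
  fun e => Matrix.single e.1.1 e.1.2 1

theorem entryFamily_isSingleEntry {Φ : Matrix M K ℂ}
    (hrow : ∀ r s t, Φ r s ≠ 0 → Φ r t ≠ 0 → s = t)
    (hcol : ∀ r m s, Φ r s ≠ 0 → Φ m s ≠ 0 → r = m) : IsSingleEntry (entryFamily Φ) := by
  refine ⟨fun e => e.1.1, fun e => e.1.2, ?_, ?_, fun e => ⟨?_, fun μ ν => ?_⟩⟩
  · rintro ⟨⟨r, s⟩, h⟩ ⟨⟨r', t⟩, h'⟩ (rfl : r = r')
    obtain rfl := hrow r s t h h'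
    rfl
  · rintro ⟨⟨r, s⟩, h⟩ ⟨⟨m, s'⟩, h'⟩ (rfl : s = s')
    obtain rfl := hcol r m s h h'
    rfl
  · simp [entryFamily]
  · simp [entryFamily, Matrix.single_apply, eq_comm]

end EntryFamily

namespace QFermionSystem

variable {q : ℝ} {M K V : Type*} [Fintype M] [DecidableEq M] [Fintype K] [DecidableEq K]
  [NormedAddCommGroup V] [InnerProductSpace ℂ V] (F : QFermionSystem q M K V)

open Classical in
theorem cre_eq_sum_entryFamily (Φ : Matrix M K ℂ) (x : V) :
    F.cre Φ x = ∑ e, Φ e.1.1 e.1.2 • F.cre (entryFamily Φ e) x := by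
  have h : ∀ e, F.cre (entryFamily Φ e) x = F.adag e.1.1 (F.bdag e.1.2 x) := fun e => by
    rw [F.cre_of_single (r := e.1.1) (s := e.1.2) (by
      simp [entryFamily, Matrix.single_apply, eq_comm])]
    simp [entryFamily]
  simp only [h]
  rw [cre_apply, ← Fintype.sum_prod_type',
    ← Finset.sum_filter_of_ne (p := fun e : M × K => Φ e.1 e.2 ≠ 0)]
  · exact Finset.sum_subtype _ (by simp) fun e : M × K => Φ e.1 e.2 • F.adag e.1 (F.bdag e.2 x)
  · intro e _ he h0
    simp [h0] at he

open Classical in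
theorem ann_eq_sum_entryFamily (Φ : Matrix M K ℂ) (x : V) :
    F.ann Φ x = ∑ e, star (Φ e.1.1 e.1.2) • F.ann (entryFamily Φ e) x :=
  ext_inner_right ℂ fun y => by
    simp only [inner_ann, sum_inner, inner_smul_left, cre_eq_sum_entryFamily F Φ y, inner_sum,
      inner_smul_right, RCLike.star_def, RingHomCompTriple.comp_apply, RingHom.id_apply]

theorem inner_vac_cre (Φ : Matrix M K ℂ) (x : V) : inner ℂ F.vac (F.cre Φ x) = (0 : ℂ) := by
  rw [← inner_ann, ann_vac, inner_zero_left]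

/-! ### Two nonzero entries as independent oscillators -/

section TwoEntries

variable {F} {Φ : Matrix M K ℂ} {e₀ e₁ : {e : M × K // Φ e.1 e.2 ≠ 0}}

/-- The state with `j` quanta in the entry `e₀` of `Φ` and `k` quanta in the entry `e₁`. -/
def pairState (F : QFermionSystem q M K V) (e₀ e₁ : {e : M × K // Φ e.1 e.2 ≠ 0}) (j k : ℕ) : V :=
  F.state (entryFamily Φ) (List.replicate j e₀ ++ List.replicate k e₁)

theorem cre_pairState_left (j k : ℕ) :
    F.cre (entryFamily Φ e₀) (F.pairState e₀ e₁ j k) = F.pairState e₀ e₁ (j + 1) k := by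
  rw [pairState, ← state_cons]
  rfl

theorem cre_pairState_right (hS : IsSingleEntry (entryFamily Φ)) (j k : ℕ) :
    F.cre (entryFamily Φ e₁) (F.pairState e₀ e₁ j k) = F.pairState e₀ e₁ j (k + 1) := by
  rw [pairState, ← state_cons, pairState]
  exact state_perm hS List.perm_middle.symm

theorem ann_pairState_left (hq : q ≠ -1) (hS : IsSingleEntry (entryFamily Φ)) (h : e₀ ≠ e₁)
    (j k : ℕ) : F.ann (entryFamily Φ e₀) (F.pairState e₀ e₁ j k) =
      ((qNum q j ^ 2 : ℝ) : ℂ) • F.pairState e₀ e₁ (j - 1) k := by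
  classical
  cases j with
  | zero =>
    rw [pairState, ann_state_of_notMem hq hS (by simp [List.mem_replicate, h]), qNum_zero]
    simp
  | succ j =>
    rw [← cre_pairState_left, pairState, ann_cre_state_append_replicate hq hS, if_pos rfl,
      if_neg h.symm]
    rfl

theorem ann_pairState_right (hq : q ≠ -1) (hS : IsSingleEntry (entryFamily Φ)) (h : e₀ ≠ e₁)
    (j k : ℕ) : F.ann (entryFamily Φ e₁) (F.pairState e₀ e₁ j k) =
      ((qNum q k ^ 2 : ℝ) : ℂ) • F.pairState e₀ e₁ j (k - 1) := by
  classical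
  cases k with
  | zero =>
    rw [pairState, ann_state_of_notMem hq hS (by simp [List.mem_replicate, h.symm]), qNum_zero]
    simp
  | succ k =>
    rw [← cre_pairState_right hS, pairState, ann_cre_state_append_replicate hq hS, if_neg h,
      if_pos rfl, zero_add]
    rfl

theorem ann_pairState_ne (hq : q ≠ -1) (hS : IsSingleEntry (entryFamily Φ))
    {e : {e : M × K // Φ e.1 e.2 ≠ 0}} (h₀ : e ≠ e₀) (h₁ : e ≠ e₁) (j k : ℕ) :
    F.ann (entryFamily Φ e) (F.pairState e₀ e₁ j k) = 0 := by
  classical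
  exact ann_state_of_notMem hq hS (by simp [List.mem_replicate, h₀, h₁])

theorem ann_pairState (hq : q ≠ -1) (hS : IsSingleEntry (entryFamily Φ)) (h : e₀ ≠ e₁)
    (j k : ℕ) : F.ann Φ (F.pairState e₀ e₁ j k) =
      (star (Φ e₀.1.1 e₀.1.2) * (qNum q j ^ 2 : ℝ) : ℂ) • F.pairState e₀ e₁ (j - 1) k +
        (star (Φ e₁.1.1 e₁.1.2) * (qNum q k ^ 2 : ℝ) : ℂ) • F.pairState e₀ e₁ j (k - 1) := by
  classical
  rw [ann_eq_sum_entryFamily, ← Finset.add_sum_erase _ _ (Finset.mem_univ e₀),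
    ← Finset.add_sum_erase _ _ (Finset.mem_erase.mpr ⟨h.symm, Finset.mem_univ e₁⟩),
    Finset.sum_eq_zero, ann_pairState_left hq hS h, ann_pairState_right hq hS h, add_zero,
    smul_smul, smul_smul]
  intro e he
  rw [ann_pairState_ne hq hS (Finset.ne_of_mem_erase (Finset.mem_of_mem_erase he))
    (Finset.ne_of_mem_erase he), smul_zero]

/-- An entry with no quanta sees `A_e A†_e = [1]² = 1`, as for an ordinary boson. -/
theorem ann_cre_pairState_ne (hq : q ≠ -1) (hS : IsSingleEntry (entryFamily Φ))
    {e : {e : M × K // Φ e.1 e.2 ≠ 0}} (h₀ : e ≠ e₀) (h₁ : e ≠ e₁) (j k : ℕ) :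
    F.ann Φ (F.cre (entryFamily Φ e) (F.pairState e₀ e₁ j k)) =
      F.cre (entryFamily Φ e) (F.ann Φ (F.pairState e₀ e₁ j k)) +
        star (Φ e.1.1 e.1.2) • F.pairState e₀ e₁ j k := by
  classical
  simp only [ann_eq_sum_entryFamily F Φ, map_sum, map_smul]
  rw [← Finset.add_sum_erase _ _ (Finset.mem_univ e),
    ← Finset.add_sum_erase _ _ (Finset.mem_univ e), ann_pairState_ne hq hS h₀ h₁, map_zero,
    smul_zero, zero_add, add_comm]
  congr 1
  · refine Finset.sum_congr rfl fun e' he' => ?_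
    rw [ann_cre_of_isSingleEntry hS (Finset.ne_of_mem_erase he')]
  · rw [pairState, ann_cre_state_append_replicate hq hS, if_neg h₀.symm, if_neg h₁.symm,
      qNum_one hq]
    simp

/-- The one quantum of `e` is removed by any of the `n + 1` factors `A`, each with the same weight.
-/
theorem inner_vac_ann_pow_cre_pairState (hq : q ≠ -1) (hS : IsSingleEntry (entryFamily Φ))
    (h : e₀ ≠ e₁) {e : {e : M × K // Φ e.1 e.2 ≠ 0}} (h₀ : e ≠ e₀) (h₁ : e ≠ e₁) (n j k : ℕ) :
    inner ℂ F.vac ((F.ann Φ ^ (n + 1)) (F.cre (entryFamily Φ e) (F.pairState e₀ e₁ j k))) =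
      (n + 1) * star (Φ e.1.1 e.1.2) *
        inner ℂ F.vac ((F.ann Φ ^ n) (F.pairState e₀ e₁ j k)) := by
  induction n generalizing j k with
  | zero =>
    rw [pow_one, ann_cre_pairState_ne hq hS h₀ h₁, inner_add_right, inner_vac_cre,
      inner_smul_right]
    simp
  | succ n ih =>
    rw [pow_succ, Module.End.mul_apply, ann_cre_pairState_ne hq hS h₀ h₁, map_add, map_smul,
      inner_add_right, inner_smul_right, pow_succ _ n, Module.End.mul_apply _ _ (F.pairState _ _ _ _),
      ann_pairState hq hS h]
    simp only [map_add, map_smul, inner_add_right, inner_smul_right, ih, ← pow_succ]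
    push_cast
    ring

/-- `β` is the sum of `|Φ_e|²` over the remaining entries. It is independent of the test vector, so
it drops out when two are compared. -/
theorem inner_vac_ann_pow_cre_pairState_eq (hq : q ≠ -1) (hS : IsSingleEntry (entryFamily Φ))
    (h : e₀ ≠ e₁) : ∃ β : ℂ, ∀ n j k : ℕ,
      inner ℂ F.vac ((F.ann Φ ^ (n + 1)) (F.cre Φ (F.pairState e₀ e₁ j k))) =
        Φ e₀.1.1 e₀.1.2 * inner ℂ F.vac ((F.ann Φ ^ (n + 1)) (F.pairState e₀ e₁ (j + 1) k)) +
        Φ e₁.1.1 e₁.1.2 * inner ℂ F.vac ((F.ann Φ ^ (n + 1)) (F.pairState e₀ e₁ j (k + 1))) +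
        (n + 1) * β * inner ℂ F.vac ((F.ann Φ ^ n) (F.pairState e₀ e₁ j k)) := by
  classical
  refine ⟨∑ e ∈ (Finset.univ.erase e₀).erase e₁, Φ e.1.1 e.1.2 * star (Φ e.1.1 e.1.2),
    fun n j k => ?_⟩
  rw [cre_eq_sum_entryFamily, ← Finset.add_sum_erase _ _ (Finset.mem_univ e₀),
    ← Finset.add_sum_erase _ _ (Finset.mem_erase.mpr ⟨h.symm, Finset.mem_univ e₁⟩),
    cre_pairState_left, cre_pairState_right hS, ← add_assoc]
  simp only [map_add, map_sum, map_smul, inner_add_right, inner_sum, inner_smul_right]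
  rw [Finset.mul_sum, Finset.sum_mul]
  refine congrArg _ (Finset.sum_congr rfl fun e he => ?_)
  rw [inner_vac_ann_pow_cre_pairState hq hS h
    (Finset.ne_of_mem_erase (Finset.mem_of_mem_erase he)) (Finset.ne_of_mem_erase he)]
  ring

theorem inner_vac_ann_pow_pairState_zero (hq : q ≠ -1) (hS : IsSingleEntry (entryFamily Φ))
    (h : e₀ ≠ e₁) (n : ℕ) :
    inner ℂ F.vac ((F.ann Φ ^ n) (F.pairState e₀ e₁ n 0)) =
      star (Φ e₀.1.1 e₀.1.2) ^ n * (∏ i ∈ Finset.range n, (qNum q (i + 1) ^ 2 : ℂ)) := by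
  induction n with
  | zero => simpa [pairState] using F.inner_vac_vac
  | succ n ih =>
    rw [pow_succ, Module.End.mul_apply, ann_pairState hq hS h, Nat.add_sub_cancel, qNum_zero,
      map_add, map_smul, map_smul, inner_add_right, inner_smul_right, ih, Finset.prod_range_succ,
      inner_smul_right]
    push_cast
    ring

theorem inner_vac_ann_pow_pairState_one (hq : q ≠ -1) (hS : IsSingleEntry (entryFamily Φ))
    (h : e₀ ≠ e₁) (n : ℕ) :
    inner ℂ F.vac ((F.ann Φ ^ (n + 1)) (F.pairState e₀ e₁ n 1)) =
      (n + 1) * star (Φ e₀.1.1 e₀.1.2) ^ n * star (Φ e₁.1.1 e₁.1.2) *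
        (∏ i ∈ Finset.range n, (qNum q (i + 1) ^ 2 : ℂ)) := by
  induction n with
  | zero =>
    rw [pow_succ, Module.End.mul_apply, ann_pairState hq hS h, Nat.sub_self, map_add, map_smul,
      map_smul, inner_add_right, inner_smul_right, inner_smul_right,
      inner_vac_ann_pow_pairState_zero hq hS h, qNum_zero, qNum_one hq]
    simp
  | succ n ih =>
    rw [pow_succ, Module.End.mul_apply, ann_pairState hq hS h, Nat.sub_self, Nat.add_sub_cancel,
      map_add, map_smul, map_smul, inner_add_right, inner_smul_right, inner_smul_right, ih,
      inner_vac_ann_pow_pairState_zero hq hS h, qNum_one hq, Finset.prod_range_succ]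
    push_cast
    ring

/-- The binomial coefficient counts the positions among the `n + 2` factors at which the two quanta
of `e₁` are removed. -/
theorem inner_vac_ann_pow_pairState_two (hq : q ≠ -1) (hS : IsSingleEntry (entryFamily Φ))
    (h : e₀ ≠ e₁) (n : ℕ) :
    inner ℂ F.vac ((F.ann Φ ^ (n + 2)) (F.pairState e₀ e₁ n 2)) =
      (n + 1) * (n + 2) / 2 * star (Φ e₀.1.1 e₀.1.2) ^ n * star (Φ e₁.1.1 e₁.1.2) ^ 2 *
        qNum q 2 ^ 2 * (∏ i ∈ Finset.range n, (qNum q (i + 1) ^ 2 : ℂ)) := by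
  induction n with
  | zero =>
    rw [pow_succ, Module.End.mul_apply, ann_pairState hq hS h, map_add, map_smul,
      map_smul, inner_add_right, inner_smul_right, inner_smul_right,
      inner_vac_ann_pow_pairState_one hq hS h, qNum_zero]
    push_cast
    simp
    ring
  | succ n ih =>
    rw [pow_succ, Module.End.mul_apply, ann_pairState hq hS h, Nat.add_sub_cancel,
      map_add, map_smul, map_smul, inner_add_right, inner_smul_right, inner_smul_right,
      show n + 1 + 1 = n + 2 from rfl, ih, show n + 2 = n + 1 + 1 from rfl,
      inner_vac_ann_pow_pairState_one hq hS h, Finset.prod_range_succ]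
    push_cast
    ring

/-- The test vectors with occupations `(n + 1, 0)` and `(n, 1)` give two expressions for the same `c
(n + 1)`. The right side is independent of `n`, so `[n]²/n` has constant differences. -/
theorem pairState_relation (hq : q < 1) (hq' : q ≠ -1) (hS : IsSingleEntry (entryFamily Φ))
    (h : e₀ ≠ e₁) {c : ℕ → ℂ}
    (hc : ∀ n, F.ann Φ ((F.cre Φ ^ (n + 1)) F.vac) = c n • (F.cre Φ ^ n) F.vac) (n : ℕ) :
    (Φ e₀.1.1 e₀.1.2 * star (Φ e₀.1.1 e₀.1.2)) *
        (qNum q (n + 2) ^ 2 / (n + 2) - qNum q (n + 1) ^ 2 / (n + 1)) =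
      (Φ e₁.1.1 e₁.1.2 * star (Φ e₁.1.1 e₁.1.2)) * (qNum q 2 ^ 2 / 2 - 1 : ℂ) := by
  obtain ⟨β, hβ⟩ := inner_vac_ann_pow_cre_pairState_eq (F := F) hq' hS h
  have h1 := F.inner_vac_ann_pow Φ (F.pairState e₀ e₁ (n + 1) 0) (n + 1) (hc (n + 1))
  have h2 := F.inner_vac_ann_pow Φ (F.pairState e₀ e₁ n 1) (n + 1) (hc (n + 1))
  rw [hβ, inner_vac_ann_pow_pairState_zero hq' hS h, inner_vac_ann_pow_pairState_zero hq' hS h,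
    zero_add, inner_vac_ann_pow_pairState_one hq' hS h] at h1
  rw [hβ, inner_vac_ann_pow_pairState_one hq' hS h, inner_vac_ann_pow_pairState_one hq' hS h,
    show n + 1 + 1 = n + 2 from rfl, inner_vac_ann_pow_pairState_two hq' hS h] at h2
  simp only [Finset.prod_range_succ] at h1 h2
  have hD : (∏ i ∈ Finset.range n, (qNum q (i + 1) ^ 2 : ℂ)) ≠ 0 :=
    Finset.prod_ne_zero_iff.mpr fun i _ => pow_ne_zero 2
      (Complex.ofReal_ne_zero.mpr (qNum_succ_pos hq hq' i).ne')
  have hQ : (qNum q (n + 1) : ℂ) ≠ 0 := Complex.ofReal_ne_zero.mpr (qNum_succ_pos hq hq' n).ne'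
  generalize (∏ i ∈ Finset.range n, (qNum q (i + 1) ^ 2 : ℂ)) = D at *
  have h₀ : star (Φ e₀.1.1 e₀.1.2) ≠ 0 := star_ne_zero.mpr e₀.2
  have h₁ : star (Φ e₁.1.1 e₁.1.2) ≠ 0 := star_ne_zero.mpr e₁.2
  generalize star (Φ e₀.1.1 e₀.1.2) = p₀ at *
  generalize star (Φ e₁.1.1 e₁.1.2) = p₁ at *
  have hn1 : (n + 1 : ℂ) ≠ 0 := Nat.cast_add_one_ne_zero n
  have hn2 : (n + 2 : ℂ) ≠ 0 := by exact_mod_cast (Nat.succ_ne_zero (n + 1))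
  push_cast at h1 h2
  have h3 : star (c (n + 1)) = Φ e₀.1.1 e₀.1.2 * p₀ * qNum q (n + 2) ^ 2 +
      (n + 2) * (Φ e₁.1.1 e₁.1.2 * p₁) + (n + 2) * β := by
    refine mul_right_cancel₀ (mul_ne_zero (mul_ne_zero (pow_ne_zero (n + 1) h₀) hD)
      (pow_ne_zero 2 hQ)) ?_
    linear_combination h1
  have h4 : star (c (n + 1)) * (n + 1) = Φ e₀.1.1 e₀.1.2 * p₀ * (n + 2) * qNum q (n + 1) ^ 2 +
      (n + 1) * (n + 2) / 2 * (Φ e₁.1.1 e₁.1.2 * p₁) * qNum q 2 ^ 2 +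
        (n + 2) * (n + 1) * β := by
    refine mul_right_cancel₀ (mul_ne_zero (mul_ne_zero (pow_ne_zero n h₀) hD) h₁) ?_
    linear_combination h2
  field_simp
  linear_combination 2 * h4 - 2 * (n + 1) * h3

end TwoEntries

/-- A matrix for which `A (A†)ⁿ⁺¹ |O⟩` is always a multiple of `(A†)ⁿ |O⟩` has at most one nonzero
entry. -/
theorem entry_unique (hq : q < 1) (hq' : q ≠ -1) {Φ : Matrix M K ℂ} {c : ℕ → ℂ}
    (hc : ∀ n, F.ann Φ ((F.cre Φ ^ (n + 1)) F.vac) = c n • (F.cre Φ ^ n) F.vac)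
    {r m : M} {s t : K} (hr : Φ r s ≠ 0) (hm : Φ m t ≠ 0) : m = r ∧ t = s := by
  have hS : IsSingleEntry (entryFamily Φ) := entryFamily_isSingleEntry
    (fun r s t => row_unique hq hq' (hc 5)) (fun r m s => column_unique hq hq' (hc 5))
  by_contra hne
  have h : (⟨(r, s), hr⟩ : {e : M × K // Φ e.1 e.2 ≠ 0}) ≠ ⟨(m, t), hm⟩ := fun h => by
    simp only [Subtype.mk.injEq, Prod.mk.injEq] at h
    exact hne ⟨h.1.symm, h.2.symm⟩
  have e0 := pairState_relation hq hq' hS h hc 0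
  have e1 := pairState_relation hq hq' hS h hc 1
  have e2 := pairState_relation hq hq' hS h hc 2
  have hX : Φ r s * star (Φ r s) ≠ 0 := mul_ne_zero hr (star_ne_zero.mpr hr)
  simp only at e0 e1 e2
  have q2 : qNum q 2 = 1 - q := by rw [qNum_succ hq', qNum_one hq']; ring
  have q3 : qNum q 3 = 1 - q + q ^ 2 := by rw [qNum_succ hq', q2]; ring
  have q4 : qNum q 4 = 1 - q + q ^ 2 - q ^ 3 := by rw [qNum_succ hq', q3]; ring
  have d1 : (qNum q 3 : ℂ) ^ 2 / 3 - (qNum q 2 : ℂ) ^ 2 / 2 = (qNum q 2 : ℂ) ^ 2 / 2 - 1 := by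
    refine mul_left_cancel₀ hX ?_
    rw [← e0] at e1
    norm_num [qNum_one hq'] at e1 ⊢
    exact e1
  have d2 : (qNum q 4 : ℂ) ^ 2 / 4 - (qNum q 3 : ℂ) ^ 2 / 3 = (qNum q 2 : ℂ) ^ 2 / 2 - 1 := by
    refine mul_left_cancel₀ hX ?_
    rw [← e0] at e2
    norm_num [qNum_one hq'] at e2 ⊢
    exact e2
  rw [q2, q3] at d1
  rw [q2, q3, q4] at d2
  have d1' : (1 - q + q ^ 2) ^ 2 / 3 - (1 - q) ^ 2 / 2 = (1 - q) ^ 2 / 2 - 1 :=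
    Complex.ofReal_injective (by push_cast at d1 ⊢; exact d1)
  have d2' : (1 - q + q ^ 2 - q ^ 3) ^ 2 / 4 - (1 - q + q ^ 2) ^ 2 / 3 = (1 - q) ^ 2 / 2 - 1 :=
    Complex.ofReal_injective (by push_cast at d2 ⊢; exact d2)
  -- With `p = [2]` the first equation factors; `p = 2` would mean `q = -1`, so `p³ = 2`. The second
  -- then reduces to a quadratic, and the Euclidean algorithm on the two leaves a rational `p` that
  -- is not a root.
  obtain ⟨p, rfl⟩ : ∃ p, q = 1 - p := ⟨1 - q, by ring⟩
  have c1 : (p - 2) * (p ^ 3 - 2) = 0 := by linear_combination 3 * d1'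
  have c2 : p ^ 3 = 2 := by
    have := (mul_eq_zero.mp c1).resolve_left fun h => hq' (by linarith)
    linarith
  have c3 : 5 * p ^ 2 - 8 * p + 2 = 0 := by
    linear_combination -2 * d1' - 2 * d2' + (p ^ 3 - 4 * p ^ 2 + 8 * p - 6) / 2 * c2
  have c4 : p = 11 / 9 := by linear_combination (-8 / 54 - 5 * p / 54) * c3 + 25 / 54 * c2
  rw [c4] at c3
  norm_num at c3

end QFermionSystem

/-! ### From a realization to condition (S) -/

namespace QFermionSystem

section

variable {q : ℝ} {M K V : Type*} [Fintype M] [DecidableEq M] [Fintype K] [DecidableEq K]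
  [NormedAddCommGroup V] [InnerProductSpace ℂ V] {F : QFermionSystem q M K V}

/-- Quasibosons that occupy two entries of the same row do not commute on the vacuum. -/
theorem cre_cre_vac_ne_of_same_row (hq : q < 1) (hq' : q ≠ -1) {Φ Ψ : Matrix M K ℂ} {r : M}
    {s t : K} (hst : s ≠ t) (hΦ : ∀ μ ν, Φ μ ν = if μ = r ∧ ν = s then Φ r s else 0)
    (hΨ : ∀ μ ν, Ψ μ ν = if μ = r ∧ ν = t then Ψ r t else 0) (hs : Φ r s ≠ 0) (ht : Ψ r t ≠ 0) :
    F.cre Φ (F.cre Ψ F.vac) ≠ F.cre Ψ (F.cre Φ F.vac) := by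
  intro h
  have h1 : F.bdag s F.vac = F.rowState r s t 0 1 0 := by simp [rowState]
  have h2 : F.bdag t F.vac = F.rowState r s t 0 0 1 := by simp [rowState]
  simp only [F.cre_of_single hΦ, F.cre_of_single hΨ, map_smul] at h
  simp only [h1, h2, F.adag_rowState, F.bdag_rowState_left, F.bdag_rowState_right hst, map_smul,
    Nat.reduceAdd] at h
  -- Both products are multiples of `(a†_r)² b†_s b†_t|O⟩` with opposite signs, so equality would
  -- make this vector vanish.
  have h3 : (2 * (Φ r s * Ψ r t)) • F.rowState r s t 2 1 1 = 0 := by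
    rw [← sub_eq_zero] at h
    rw [← neg_eq_zero, ← h]
    norm_num
    module
  have h4 := (smul_eq_zero.mp h3).resolve_left
    (mul_ne_zero two_ne_zero (mul_ne_zero hs ht))
  -- Lowering by `a_r` twice, then `b_s` and `b_t`, returns a nonzero multiple of the vacuum,
  -- because `[1]` and `[2]` are nonzero.
  have h5 := F.a_rowState (r := r) (s := s) (t := t) hq' 2 1 1
  rw [h4, map_zero] at h5
  have h6 := (smul_eq_zero.mp h5.symm).resolve_left (mul_ne_zero (by simp)
    (Complex.ofReal_ne_zero.mpr (qNum_succ_pos hq hq' 1).ne'))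
  have h7 := F.a_rowState (r := r) (s := s) (t := t) hq' 1 1 1
  rw [h6, map_zero] at h7
  have h8 := (smul_eq_zero.mp h7.symm).resolve_left (mul_ne_zero (by simp)
    (Complex.ofReal_ne_zero.mpr (qNum_succ_pos hq hq' 0).ne'))
  have h9 := F.b_rowState_left (r := r) hq' hst 0 1 1
  rw [show F.rowState r s t 0 1 1 = 0 from h8, map_zero, qNum_one hq', Complex.ofReal_one,
    one_smul] at h9
  have h10 := F.b_rowState_right (r := r) hq' hst 0 0 1
  rw [show F.rowState r s t 0 0 1 = 0 from h9.symm, map_zero, qNum_one hq'] at h10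
  refine F.vac_ne_zero ?_
  simpa [rowState] using h10.symm

theorem cre_cre_vac_ne_of_same_column (hq : q < 1) (hq' : q ≠ -1) {Φ Ψ : Matrix M K ℂ} {r m : M}
    {s : K} (hrm : r ≠ m) (hΦ : ∀ μ ν, Φ μ ν = if μ = r ∧ ν = s then Φ r s else 0)
    (hΨ : ∀ μ ν, Ψ μ ν = if μ = m ∧ ν = s then Ψ m s else 0) (hr : Φ r s ≠ 0) (hm : Ψ m s ≠ 0) :
    F.cre Φ (F.cre Ψ F.vac) ≠ F.cre Ψ (F.cre Φ F.vac) := by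
  have h := cre_cre_vac_ne_of_same_row (F := F.swap) (Φ := Φ.transpose) (Ψ := Ψ.transpose)
    hq hq' hrm (fun ν μ => by simpa [and_comm] using hΦ μ ν)
    (fun ν μ => by simpa [and_comm] using hΨ μ ν) hr hm
  rw [cre_swap, cre_swap] at h
  simp only [LinearMap.neg_apply, map_neg, neg_neg] at h
  exact h

end

section Realization

variable {q : ℝ} {M K ι V : Type*} [Fintype M] [DecidableEq M] [Fintype K] [DecidableEq K]
  [NormedAddCommGroup V] [InnerProductSpace ℂ V] {F : QFermionSystem q M K V}
  {Φ : ι → Matrix M K ℂ} {φ : ℝ → ℝ} {N : ι → Module.End ℂ V}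

theorem IsRealization.number_cre_pow (h : F.IsRealization Φ φ N) (α : ι) (n : ℕ) :
    N α ((F.cre (Φ α) ^ n) F.vac) = (n : ℂ) • (F.cre (Φ α) ^ n) F.vac := by
  induction n with
  | zero => simp [h.number_vac α]
  | succ n ih =>
    have h1 := (h.number_rel α).1 _ (F.state_mem Φ (List.replicate n α))
    rw [state_replicate, LieRing.of_associative_ring_bracket, LinearMap.sub_apply,
      Module.End.mul_apply, Module.End.mul_apply, ih, map_smul, ← Module.End.mul_apply (F.cre _),
      ← pow_succ', sub_eq_iff_eq_add] at h1
    rw [h1]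
    push_cast
    module

/-- This is all that `entry_unique` needs from the realization; the eigenvalue of `N + 1` on
`(A†)ⁿ|O⟩` is `n + 1`. -/
theorem IsRealization.ann_cre_pow (h : F.IsRealization Φ φ N) (α : ι) (n : ℕ) :
    F.ann (Φ α) ((F.cre (Φ α) ^ (n + 1)) F.vac) =
      (φ (n + 1 : ℕ) : ℂ) • (F.cre (Φ α) ^ n) F.vac := by
  have h1 := h.ann_cre α _ (F.state_mem Φ (List.replicate n α))
  rw [state_replicate] at h1
  rw [pow_succ', Module.End.mul_apply]
  refine opFun_apply_eigenvector h1 (x := (n + 1 : ℕ)) ?_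
  rw [LinearMap.add_apply, Module.End.one_apply, h.number_cre_pow]
  push_cast
  module

theorem IsRealization.structure_function_zero (h : F.IsRealization Φ φ N) (α : ι) : φ 0 = 0 := by
  have h1 := h.cre_ann α _ (F.state_mem Φ [])
  rw [state_nil] at h1
  have h2 := opFun_apply_eigenvector h1 (x := 0) (by rw [h.number_vac]; simp)
  rw [Module.End.mul_apply, ann_vac, map_zero] at h2
  exact Complex.ofReal_eq_zero.mp ((smul_eq_zero.mp h2.symm).resolve_right F.vac_ne_zero)

variable [DecidableEq ι]

theorem IsRealization.structure_function (hq : q < 1) (hq' : q ≠ -1)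
    (h : F.IsRealization Φ φ N) (hS : IsSingleEntry Φ) (α : ι) (n : ℕ) :
    φ n = qNum q n ^ 2 := by
  cases n with
  | zero => simpa [qNum_zero] using h.structure_function_zero α
  | succ n =>
    have h1 := h.ann_cre_pow α n
    rw [pow_succ', Module.End.mul_apply, ← state_replicate, ann_cre_state hq' hS,
      List.count_replicate_self] at h1
    exact (Complex.ofReal_injective
      (smul_left_injective ℂ (state_ne_zero (F := F) hq hq' hS (List.replicate n α)) h1)).symm

theorem IsRealization.isSingleEntry (hq : q < 1) (hq' : q ≠ -1) (hΦ : IsNormalized Φ)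
    (h : F.IsRealization Φ φ N) : IsSingleEntry Φ := by
  have htr : ∀ α β, (∑ μ, ∑ ν, Φ α μ ν * star (Φ β μ ν)) = if α = β then 1 else 0 := fun α β => by
    rw [← hΦ α β]
    simp [Matrix.trace, Matrix.mul_apply]
  have hex : ∀ α, ∃ r s, Φ α r s ≠ 0 := fun α => by
    by_contra! h0
    have := htr α α
    simp [h0] at this
  choose μ₀ ν₀ hne using hex
  have hsingle : ∀ α μ ν, Φ α μ ν = if μ = μ₀ α ∧ ν = ν₀ α then Φ α (μ₀ α) (ν₀ α) else 0 := by
    intro α μ ν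
    split_ifs with he
    · rw [he.1, he.2]
    · by_contra h0
      exact he (F.entry_unique hq hq' (h.ann_cre_pow α) (hne α) h0)
  have hsum : ∀ α β, Φ α (μ₀ α) (ν₀ α) * star (Φ β (μ₀ α) (ν₀ α)) = if α = β then 1 else 0 := by
    intro α β
    rw [← htr, Finset.sum_eq_single (μ₀ α), Finset.sum_eq_single (ν₀ α)]
    · exact fun ν _ hν => by rw [hsingle α, if_neg fun h => hν h.2, zero_mul]
    · simp
    · exact fun μ _ hμ => Finset.sum_eq_zero fun ν _ => by
        rw [hsingle α, if_neg fun h => hμ h.1, zero_mul]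
    · simp
  -- Two matrices supported at the same position cannot be trace-orthogonal.
  have hdisj : ∀ α β, α ≠ β → ¬ (μ₀ α = μ₀ β ∧ ν₀ α = ν₀ β) := fun α β hαβ he => by
    have h0 := hsum α β
    rw [if_neg hαβ, he.1, he.2] at h0
    rcases mul_eq_zero.mp h0 with h1 | h1
    · exact hne α (by rw [he.1, he.2]; exact h1)
    · exact hne β (star_eq_zero.mp h1)
  have hcomm : ∀ α β, α ≠ β →
      F.cre (Φ α) (F.cre (Φ β) F.vac) = F.cre (Φ β) (F.cre (Φ α) F.vac) := fun α β hαβ => by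
    have h0 := h.cre_cre α β hαβ _ (F.state_mem Φ [])
    rw [state_nil, LieRing.of_associative_ring_bracket, LinearMap.sub_apply] at h0
    exact sub_eq_zero.mp h0
  refine ⟨μ₀, ν₀, fun α β he => ?_, fun α β he => ?_, fun α => ⟨?_, hsingle α⟩⟩
  · by_contra hαβ
    have hν : ν₀ α ≠ ν₀ β := fun he' => hdisj α β hαβ ⟨he, he'⟩
    have hβ := hsingle β
    have hβ' := hne β
    rw [← he] at hβ hβ'
    exact cre_cre_vac_ne_of_same_row hq hq' hν (hsingle α) hβ (hne α) hβ' (hcomm α β hαβ)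
  · by_contra hαβ
    have hμ : μ₀ α ≠ μ₀ β := fun he' => hdisj α β hαβ ⟨he', he⟩
    have hβ := hsingle β
    have hβ' := hne β
    rw [← he] at hβ hβ'
    exact cre_cre_vac_ne_of_same_column hq hq' hμ (hsingle α) hβ (hne α) hβ' (hcomm α β hαβ)
  · have h0 := hsum α α
    rw [if_pos rfl, RCLike.star_def, Complex.mul_conj'] at h0
    have h1 : ‖Φ α (μ₀ α) (ν₀ α)‖ ^ 2 = 1 := by exact_mod_cast h0
    exact (pow_eq_one_iff_of_nonneg (norm_nonneg _) two_ne_zero).mp h1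

end Realization

end QFermionSystem

end

theorem mainTheorem1 {M K ι V : Type*} [Fintype M] [DecidableEq M] [Fintype K] [DecidableEq K]
    [DecidableEq ι] [Nonempty ι] [NormedAddCommGroup V] [InnerProductSpace ℂ V]
    (q : ℝ) (hq : q < 1) (hq' : q ≠ -1) (F : QFermionSystem q M K V)
    (Φ : ι → Matrix M K ℂ) (hΦ : IsNormalized Φ) :
    (∀ (φ : ℝ → ℝ) (N : ι → Module.End ℂ V), F.IsRealization Φ φ N →
      IsSingleEntry Φ ∧ ∀ n : ℕ, φ n = qNum q n ^ 2) ∧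
    (∀ φ : ℝ → ℝ, IsSingleEntry Φ → (∀ n : ℕ, φ n = qNum q n ^ 2) →
      ∃ N : ι → Module.End ℂ V, F.IsRealization Φ φ N ∧
        ∀ α β, α ≠ β → F.WeakEq Φ ⁅N α, F.cre (Φ β)⁆ 0 ∧ F.WeakEq Φ ⁅N α, F.ann (Φ β)⁆ 0) ∧
    (IsSingleEntry Φ → ∀ (χ : ℝ → ℝ → ℝ) (α : ι),
      (∃ N : Module.End ℂ V,
        F.WeakEqFun₂ Φ N (F.cre (Φ α) * F.ann (Φ α)) (F.ann (Φ α) * F.cre (Φ α)) χ) ∧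
      ∀ N : Module.End ℂ V,
        F.WeakEqFun₂ Φ N (F.cre (Φ α) * F.ann (Φ α)) (F.ann (Φ α) * F.cre (Φ α)) χ →
        (F.NumberRel Φ N α ↔ ∀ n : ℕ,
          χ (qNum q (n + 1) ^ 2) (qNum q (n + 2) ^ 2) - χ (qNum q n ^ 2) (qNum q (n + 1) ^ 2)
            = 1)) := by
  refine ⟨fun φ N h => ?_, fun φ hS hφ => QFermionSystem.exists_isRealization hq hq' hS hφ,
    fun hS χ α => ⟨QFermionSystem.exists_number_function hq hq' hS χ α, fun N hN =>
      QFermionSystem.numberRel_number_function_iff hq hq' hS hN⟩⟩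
  have hS := h.isSingleEntry hq hq' hΦ
  exact ⟨hS, h.structure_function hq hq' hS (Classical.arbitrary ι)⟩
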